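/- Let $M$ be a smooth (Hausdorff, second countable) manifold of dimension $n+1$ with a smooth locally free action of the commutative Lie group $H=\mathbb{R}^n$ (written $(h,x)\mapsto hx$), and let $F$ be the codimension-one foliation of $M$ whose leaves are the orbits. Let $P\subset M$ be a connected one-dimensional embedded submanifold that is a closed subset of $M$, is transverse to $F$ and meets every leaf, and let $p:\mathbb{R}\to P$ be a smooth regular parametrization of $P$ (bijective if $P$ is a line, the periodic universal covering if $P$ is a circle). A *translation along $P$* is a differentiable map $c:\mathbb{R}\to H$ with $c(t)p(t)\in P$ for all $t$. Suppose that $P$ satisfies the following condition. $(*)$ (a) For every $t_0\in\mathbb{R}$ and every $h\in H$ with $h\,p(t_0)\in P$ there is a translation $c$ along $P$ with $c(t_0)=h$. (b) (No turns.) If $c_1,c_2$ are translations along $P$ and $p(t),p(t')$ lie on the same leaf, then the displacement vectors $c_1(t)-c_2(t)$ and $c_1(t')-c_2(t')$ in $\mathbb{R}^n$ have the same direction, that is, both are zero or one is a positive multiple of the other. (In particular (b) holds if the translation along $P$ of $L\cap P$, from a leaf $L$ back to itself, is an isometry of $\mathbb{R}^n$ without rotational part. The lengths of the displacements need not be preserved.)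 Then the action can be replaced by another smooth locally free action of $H=\mathbb{R}^n$ on $M$ with the same orbits (so with the same foliation $F$) for which $P$ is invariant: $hP\cap P\neq\emptyset$ implies $hP=P$, for every $h\in H$. Moreover $P$ defines an Ehresmann connection for $(M,F)$ invariant under the new action: there is a smooth line field $D$ on $M$, complementary to $TF$, invariant under the new action and equal to $TP$ along $P$, such that for every piecewise smooth curve $v:[0,1]\to M$ tangent to $F$ and every piecewise smooth curve $w:[0,1]\to M$ tangent to $D$ with $v(0)=w(0)$ there is a piecewise smooth $R:[0,1]^2\to M$ with $R(s,0)=v(s)$, $R(0,t)=w(t)$, all curves $R(\cdot,t)$ tangent to $F$ and all curves $R(s,\cdot)$ tangent to $D$. -/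

import Mathlib

open scoped Manifold ContDiff

/-- The additive Lie group `ℝⁿ`, with its Euclidean structure. -/
abbrev Vec (n : ℕ) : Type := EuclideanSpace ℝ (Fin n)

section Actions

variable {n : ℕ} {M : Type*} [TopologicalSpace M] [ChartedSpace (Vec (n + 1)) M]

/-- `φ` is a smooth action of the additive group `ℝⁿ` on the `(n+1)`-dimensional manifold `M`. -/
structure IsSmoothAction (φ : Vec n → M → M) : Prop where
  zero_act : ∀ x, φ 0 x = x
  add_act : ∀ h k x, φ (h + k) x = φ h (φ k x)
  smooth : ContMDiff (𝓘(ℝ, Vec n).prod (𝓡 (n + 1))) (𝓡 (n + 1)) ∞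
    (fun q : Vec n × M => φ q.1 q.2)

/-- The action is locally free: every isotropy group is discrete. As isotropy groups are
subgroups, this says that `0` is isolated in each of them. -/
def IsLocallyFree (φ : Vec n → M → M) : Prop :=
  ∀ x, ∃ U : Set (Vec n), IsOpen U ∧ (0 : Vec n) ∈ U ∧ ∀ h ∈ U, φ h x = x → h = 0

/-- The leaf through `x` of the foliation given by the action: the orbit of `x`. -/
def leaf (φ : Vec n → M → M) (x : M) : Set M := Set.range (fun h => φ h x)

/-- The tangent space at `x = φ 0 x` of the leaf through `x`: the image of the differential at `0`
of the orbit map `h ↦ φ h x`. -/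
noncomputable def leafTangent (φ : Vec n → M → M) (x : M) :
    Submodule ℝ (TangentSpace (𝓡 (n + 1)) x) :=
  (LinearMap.range (mfderiv 𝓘(ℝ, Vec n) (𝓡 (n + 1)) (fun h : Vec n => φ h x) 0).toLinearMap :
    Submodule ℝ (Vec (n + 1)))

/-- The velocity of a curve in `M`. -/
noncomputable def velocity (γ : ℝ → M) (t : ℝ) : TangentSpace (𝓡 (n + 1)) (γ t) :=
  mfderiv 𝓘(ℝ, ℝ) (𝓡 (n + 1)) γ t (1 : ℝ)

/-- `P` is a closed connected (one-dimensional, embedded) transversal of the foliation given by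
`φ`, which is total, that is, meets every leaf; and `p` is a regular parametrization of `P`. The
curve `p` is either injective (`T = 0`; then `P` is a line) or injective up to a period `T ≠ 0`
(then `P` is a circle). As `p` is an open map onto `P` for the topology of `P` as a subspace of
`M`, the set `P` is an embedded submanifold. -/
structure IsClosedTransversal (φ : Vec n → M → M) (P : Set M) (p : ℝ → M) : Prop where
  smooth : ContMDiff 𝓘(ℝ, ℝ) (𝓡 (n + 1)) ∞ p
  range_eq : Set.range p = P
  fibers : ∃ T : ℝ, ∀ t t', p t = p t' ↔ ∃ m : ℤ, t' = t + m * T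
  embedded : IsOpenMap (Set.rangeFactorization p)
  closed : IsClosed P
  transverse : ∀ t, velocity p t ∉ leafTangent φ (p t)
  total : ∀ x, (leaf φ x ∩ P).Nonempty

/-- `c` is a translation along `P`: it moves differentiably with `t`, and carries the point
`p t` of `P` to a point of `P` on the same leaf. -/
structure IsTranslation (φ : Vec n → M → M) (P : Set M) (p : ℝ → M) (c : ℝ → Vec n) : Prop where
  differentiable : Differentiable ℝ c
  mem : ∀ t, φ (c t) (p t) ∈ P

/-- The intersections of the leaves with `P` can be translated along all of `P`, without turns.

* `exists_translation`: every `h` that carries a point `p t₀` of `P` to a point of `P` extends to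
  a translation along `P`.
* `no_turn`: whenever the translation along `P`, from `p t` to `p t'`, returns to the same leaf,
  the displacement in `ℝⁿ` between any two translated points has the same direction at `t'` as at
  `t`. (For an isometry of the Euclidean space `ℝⁿ` without rotational part, the displacement
  itself would be the same.) -/
structure TranslatesWithoutTurns (φ : Vec n → M → M) (P : Set M) (p : ℝ → M) : Prop where
  exists_translation : ∀ (t₀ : ℝ) (h : Vec n), φ h (p t₀) ∈ P →
    ∃ c : ℝ → Vec n, IsTranslation φ P p c ∧ c t₀ = h
  no_turn : ∀ c₁ c₂ : ℝ → Vec n, IsTranslation φ P p c₁ → IsTranslation φ P p c₂ →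
    ∀ t t', p t' ∈ leaf φ (p t) → SameRay ℝ (c₁ t - c₂ t) (c₁ t' - c₂ t')

/-- `P` is invariant under `ψ`: if `hP` meets `P`, then `hP = P`. -/
def IsInvariantTransversal (ψ : Vec n → M → M) (P : Set M) : Prop :=
  ∀ h, (ψ h '' P ∩ P).Nonempty → ψ h '' P = P

/-- `γ`, restricted to `[0,1]`, is a piecewise smooth curve tangent to the field of subspaces `E`.
The finite set `S` contains the break points: `γ` is smooth on each closed subinterval of `[0,1]`
with no break point in its interior. -/
def IsTangentCurve (E : ∀ x : M, Submodule ℝ (TangentSpace (𝓡 (n + 1)) x)) (γ : ℝ → M) : Prop :=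
  ∃ S : Finset ℝ,
    (∀ a b, 0 ≤ a → a < b → b ≤ 1 → (∀ s ∈ S, s ∉ Set.Ioo a b) →
      ContMDiffOn 𝓘(ℝ, ℝ) (𝓡 (n + 1)) ∞ γ (Set.Icc a b)) ∧
    ∀ t ∈ Set.Ioo (0 : ℝ) 1, t ∉ S → velocity γ t ∈ E (γ t)

/-- `R`, restricted to `[0,1]²`, is piecewise smooth: smooth on each closed subrectangle whose
sides have no break point in their interior. -/
def IsPiecewiseSmoothSquare (R : ℝ × ℝ → M) : Prop :=
  ∃ S : Finset ℝ, ∀ a b c d, 0 ≤ a → a < b → b ≤ 1 → 0 ≤ c → c < d → d ≤ 1 →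
    (∀ s ∈ S, s ∉ Set.Ioo a b ∧ s ∉ Set.Ioo c d) →
      ContMDiffOn 𝓘(ℝ, ℝ × ℝ) (𝓡 (n + 1)) ∞ R (Set.Icc a b ×ˢ Set.Icc c d)

/-- The field of lines `D` is an Ehresmann connection for the codimension-one foliation given by
`φ`: a smooth distribution complementary to the leaves, such that every vertical curve `v` (tangent
to the leaves) and every horizontal curve `w` (tangent to `D`) with the same initial point are the
initial edges of a rectangle whose edges `R (·, t)` are vertical and `R (s, ·)` horizontal. -/
structure IsEhresmannConnection [IsManifold (𝓡 (n + 1)) ∞ M] (φ : Vec n → M → M)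
    (D : ∀ x : M, Submodule ℝ (TangentSpace (𝓡 (n + 1)) x)) : Prop where
  smooth : ∀ x, ∃ (U : Set M) (X : ∀ y : M, TangentSpace (𝓡 (n + 1)) y), IsOpen U ∧ x ∈ U ∧
    ContMDiffOn (𝓡 (n + 1)) (𝓡 (n + 1)).tangent ∞
      (fun y => (⟨y, X y⟩ : TangentBundle (𝓡 (n + 1)) M)) U ∧
    ∀ y ∈ U, D y = Submodule.span ℝ {X y}
  compl : ∀ x, IsCompl (leafTangent φ x) (D x)
  rectangle : ∀ v w : ℝ → M, IsTangentCurve (leafTangent φ) v → IsTangentCurve D w → v 0 = w 0 →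
    ∃ R : ℝ × ℝ → M, IsPiecewiseSmoothSquare (n := n) R ∧
      (∀ s ∈ Set.Icc (0 : ℝ) 1, R (s, 0) = v s) ∧
      (∀ t ∈ Set.Icc (0 : ℝ) 1, R (0, t) = w t) ∧
      (∀ t ∈ Set.Icc (0 : ℝ) 1, IsTangentCurve (leafTangent φ) (fun s => R (s, t))) ∧
      ∀ s ∈ Set.Icc (0 : ℝ) 1, IsTangentCurve D (fun t => R (s, t))

/-- The field of subspaces `D` is invariant under the action `ψ`. -/
def IsInvariantField (ψ : Vec n → M → M)
    (D : ∀ x : M, Submodule ℝ (TangentSpace (𝓡 (n + 1)) x)) : Prop :=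
  ∀ h x, (D x).map (mfderiv (𝓡 (n + 1)) (𝓡 (n + 1)) (ψ h) x).toLinearMap = D (ψ h x)

end Actions

/-! The proof constructs a smooth family of diffeomorphisms `G t` of `ℝⁿ` fixing `0` that
straightens the returns to `P` (`IsAdaptedFamily`). Put `Ψ (k, t) = φ (G t k) (p t)` (`adaptedBox`).
Two properties matter. A label `γ` with `G t γ` carrying `p t` into `P` does so for every parameter.
And if `G t γ` carries `p t` to `p t'`, then `G t' k = G t (k + γ) - G t γ`, that is, `Ψ (k, t') = Ψ
(k + γ, t)`. Hence `Ψ` is a covering of `M` by `ℝⁿ × ℝ` whose identifications are translations in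
`k` combined with reparametrizations of `t`. They commute with all translations in `k` and permute
the lines `{k} × ℝ`. So translation in `k` descends to the new action, and the direction of `t`
descends to the invariant field `D`. A rectangle for `D` is the image under `Ψ` of a product of the
lifts of the two given edges.

The family `G` comes from condition `(*)`. A translation is determined by one value, and the returns
to a point of `P` form a closed discrete set. There are two situations
(`TranslatesWithoutTurns.exists_isAdaptedFamily`).

If at every parameter some two displacements are independent, no turning forces the displacements at
two points of a leaf to differ by a homothety. A contraction factor would make the returns
accumulate, so factors are at least `1`; exchanging the two points, they equal `1`
(`TranslatesWithoutTurns.exists_dilation`). Translations are then constant on leaves and form a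
lattice. A `ℤ`-basis of it is independent over `ℝ` at each parameter and extends to a smooth frame,
and `G t` is the linear map given by this frame. The same argument covers the case of no nonzero
translation.

Otherwise all displacements at some parameter are collinear. If they are not all zero, no turning
preserves their order on the line, so the translations are ordered like `ℤ` and composition is
addition of indices (`TranslatesWithoutTurns.exists_isTranslationSequence`). Lengths may now vary
within a leaf, so `G t` is nonlinear in this direction: it interpolates smoothly between the
returns, by a formula that commutes with shifts of the index (`interp_add_intCast`).

In both situations the frame at `t` must depend only on the vectors it extends, so that it agrees at
points of one leaf (`exists_frame`). -/

open scoped Topology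

/-! ### Calculus on manifolds -/

section ManifoldTools

variable {m : ℕ} {M : Type*} [TopologicalSpace M] [ChartedSpace (Vec m) M]
  [IsManifold (𝓡 m) ∞ M]
  {E : Type*} [NormedAddCommGroup E] [NormedSpace ℝ E]

/-- The inverse function theorem for maps from a vector space to a manifold. -/
theorem isLocalDiffeomorph_of_injective_mfderiv [FiniteDimensional ℝ E]
    (hE : Module.finrank ℝ E = m) {F : E → M} (hF : ContMDiff 𝓘(ℝ, E) (𝓡 m) ∞ F)
    (hinj : ∀ e, Function.Injective (mfderiv 𝓘(ℝ, E) (𝓡 m) F e)) :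
    IsLocalDiffeomorph 𝓘(ℝ, E) (𝓡 m) ∞ F := by
  intro e
  have : CompleteSpace E := FiniteDimensional.complete ℝ E
  set c := chartAt (Vec m) (F e) with hc
  have hcm : c.MDifferentiable (𝓡 m) (𝓡 m) := mdifferentiable_chart (F e)
  have hU : IsOpen (F ⁻¹' c.source) := c.open_source.preimage hF.continuous
  have hg : ∀ y ∈ F ⁻¹' c.source, ContDiffAt ℝ ∞ (c ∘ F) y := fun y hy =>
    contMDiffAt_iff_contDiffAt.1
      ((contMDiffAt_of_mem_maximalAtlas (IsManifold.chart_mem_maximalAtlas (F e)) hy).comp y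
        hF.contMDiffAt)
  have hg' : ∀ y ∈ F ⁻¹' c.source, ∃ L : E ≃L[ℝ] Vec m,
      HasFDerivAt (c ∘ F) (L : E →L[ℝ] Vec m) y := by
    intro y hy
    have hd := ((hg y hy).differentiableAt (by simp)).hasFDerivAt
    have hi : Function.Injective (fderiv ℝ (c ∘ F) y) := by
      rw [← mfderiv_eq_fderiv]
      have h2 := mfderiv_comp (I := 𝓘(ℝ, E)) (I' := 𝓡 m) (I'' := 𝓡 m) y (g := c) (f := F)
        (hcm.mdifferentiableAt hy) (hF.mdifferentiableAt (by simp))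
      rw [show mfderiv 𝓘(ℝ, E) 𝓘(ℝ, Vec m) (c ∘ F) y = _ from h2]
      exact (hcm.mfderiv_injective hy).comp (hinj y)
    have hfr : Module.finrank ℝ E = Module.finrank ℝ (Vec m) := by simp [hE]
    refine ⟨(LinearEquiv.ofInjectiveOfFinrankEq (fderiv ℝ (c ∘ F) y).toLinearMap hi hfr
      ).toContinuousLinearEquiv, ?_⟩
    exact hd.congr_fderiv (ContinuousLinearMap.ext fun v => rfl)
  obtain ⟨L, hL⟩ := hg' e (mem_chart_source _ _)
  have hge := hg e (mem_chart_source _ _)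
  -- The local inverse of `c ∘ F` is restricted to points that `F` sends into the chart domain, so
  -- that composing with `c.symm` gives back `F`.
  set f := (hge.toOpenPartialHomeomorph (c ∘ F) hL (by simp)).restrOpen _ hU with hf
  have hfc : ∀ y, f y = c (F y) := fun y => rfl
  have hef : e ∈ f.source :=
    ⟨hge.mem_toOpenPartialHomeomorph_source hL (by simp), mem_chart_source _ _⟩
  have hfs : ∀ y ∈ f.source, F y ∈ c.source := fun y hy => hy.2
  set Q := f.trans c.symm with hQ
  have hQF : ∀ y ∈ Q.source, F y = Q y := fun y hy => by
    rw [hQ, OpenPartialHomeomorph.trans_apply, hfc, c.left_inv (hfs y hy.1)]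
  refine ⟨⟨Q.toPartialEquiv, Q.open_source, Q.open_target, ?_, ?_⟩, ?_, hQF⟩
  · exact hF.contMDiffOn.congr fun y hy => (hQF y hy).symm
  · intro x hx
    have hx2 : x ∈ c.source := hx.1
    have hx3 : c x ∈ f.target := hx.2
    obtain ⟨L', hL'⟩ := hg' (f.symm (c x)) (hfs _ (f.map_target hx3))
    have h1 : ContDiffAt ℝ ∞ f.symm (c x) :=
      f.contDiffAt_symm hx3 hL' (hg _ (hfs _ (f.map_target hx3)))
    exact ((contMDiffAt_iff_contDiffAt.2 h1).comp x (contMDiffAt_of_mem_maximalAtlas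
      (IsManifold.chart_mem_maximalAtlas (F e)) hx2)).contMDiffWithinAt
  · refine ⟨hef, ?_⟩
    change c (F e) ∈ c.target
    exact c.map_source (mem_chart_source _ _)

/-- A smooth curve with zero velocity is constant. -/
theorem eq_of_mfderiv_eq_zero [T2Space M] {γ : ℝ → M} (hγ : ContMDiff 𝓘(ℝ, ℝ) (𝓡 m) ∞ γ)
    (h0 : ∀ t, mfderiv 𝓘(ℝ, ℝ) (𝓡 m) γ t = 0) (s t : ℝ) : γ s = γ t := by
  refine IsLocallyConstant.apply_eq_of_isPreconnected (s := Set.univ) ?_ isPreconnected_univ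
    trivial trivial
  rw [IsLocallyConstant.iff_eventually_eq]
  intro a
  set c := chartAt (Vec m) (γ a) with hc
  have hcm : c.MDifferentiable (𝓡 m) (𝓡 m) := mdifferentiable_chart (γ a)
  have hU : IsOpen (γ ⁻¹' c.source) := c.open_source.preimage hγ.continuous
  obtain ⟨ε, hε, hball⟩ := Metric.isOpen_iff.1 hU a (mem_chart_source _ _)
  have hd : ∀ y ∈ Metric.ball a ε, HasFDerivWithinAt (c ∘ γ) (0 : ℝ →L[ℝ] Vec m)
      (Metric.ball a ε) y := by
    intro y hy
    have h2 := HasMFDerivAt.comp (I := 𝓘(ℝ, ℝ)) (I' := 𝓡 m) (I'' := 𝓡 m) y (g := c) (f := γ)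
        (hcm.mdifferentiableAt (hball hy)).hasMFDerivAt
        (hγ.mdifferentiableAt (by simp)).hasMFDerivAt
    rw [h0 y] at h2
    have h3 := hasMFDerivAt_iff_hasFDerivAt.1 h2
    refine HasFDerivAt.hasFDerivWithinAt ?_
    exact h3.congr_fderiv (ContinuousLinearMap.comp_zero _)
  filter_upwards [Metric.ball_mem_nhds a hε] with y hy
  refine c.injOn (hball hy) (mem_chart_source _ _) ?_
  exact (convex_ball a ε).is_const_of_fderivWithin_eq_zero (𝕜 := ℝ) (f := c ∘ γ)
    (fun z hz => (hd z hz).differentiableWithinAt)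
    (fun z hz => (hd z hz).fderivWithin (Metric.isOpen_ball.uniqueDiffWithinAt hz)) hy
    (Metric.mem_ball_self hε)

end ManifoldTools

/-! ### Chain rules for maps from vector spaces -/

section ActionTools

variable {m : ℕ} {M : Type*} [TopologicalSpace M] [ChartedSpace (Vec m) M]
  {E : Type*} [NormedAddCommGroup E] [NormedSpace ℝ E]
  {E' : Type*} [NormedAddCommGroup E'] [NormedSpace ℝ E']

theorem mfderiv_comp_of_hasFDerivAt {F : E → M} {g : E' → E} {g' : E' →L[ℝ] E} {x : E'}
    (hF : MDifferentiableAt 𝓘(ℝ, E) (𝓡 m) F (g x)) (hg : HasFDerivAt g g' x) (v : E') :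
    (mfderiv 𝓘(ℝ, E') (𝓡 m) (fun y => F (g y)) x v : Vec m) =
      (mfderiv 𝓘(ℝ, E) (𝓡 m) F (g x) (g' v) : Vec m) := by
  have h := (HasMFDerivAt.comp x hF.hasMFDerivAt (hasMFDerivAt_iff_hasFDerivAt.2 hg)).mfderiv
  exact congrArg (fun L : E' →L[ℝ] Vec m => L v) h

theorem mfderiv_prod_apply {F : E × ℝ → M} {k : E} {t : ℝ}
    (hF : MDifferentiableAt 𝓘(ℝ, E × ℝ) (𝓡 m) F (k, t)) (v : E) (s : ℝ) :
    (mfderiv 𝓘(ℝ, E × ℝ) (𝓡 m) F (k, t) (v, s) : Vec m) =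
      (mfderiv 𝓘(ℝ, E) (𝓡 m) (fun k => F (k, t)) k v : Vec m) +
        (mfderiv 𝓘(ℝ, ℝ) (𝓡 m) (fun t => F (k, t)) t s : Vec m) := by
  rw [mfderiv_comp_of_hasFDerivAt (g := fun k : E => (k, t)) hF (hasFDerivAt_prodMk_left k t),
    mfderiv_comp_of_hasFDerivAt (g := fun t : ℝ => (k, t)) hF (hasFDerivAt_prodMk_right k t)]
  have : ((v, s) : E × ℝ) = (v, 0) + (0, s) := by simp
  rw [this]
  exact map_add (mfderiv 𝓘(ℝ, E × ℝ) (𝓡 m) F (k, t)) _ _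

end ActionTools

/-! ### Smooth locally free actions -/

section LocallyFreeActions

variable {n : ℕ} {M : Type*} [TopologicalSpace M] [ChartedSpace (Vec (n + 1)) M]
  {φ : Vec n → M → M}

theorem IsSmoothAction.neg_act (hφ : IsSmoothAction φ) (h : Vec n) (x : M) :
    φ (-h) (φ h x) = x := by
  rw [← hφ.add_act, neg_add_cancel, hφ.zero_act]

theorem IsSmoothAction.contMDiff_comp (hφ : IsSmoothAction φ)
    {H' : Type*} [TopologicalSpace H'] {E' : Type*} [NormedAddCommGroup E'] [NormedSpace ℝ E']
    {I' : ModelWithCorners ℝ E' H'} {N : Type*} [TopologicalSpace N] [ChartedSpace H' N]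
    {f : N → Vec n} {g : N → M}
    (hf : ContMDiff I' 𝓘(ℝ, Vec n) ∞ f) (hg : ContMDiff I' (𝓡 (n + 1)) ∞ g) :
    ContMDiff I' (𝓡 (n + 1)) ∞ (fun y => φ (f y) (g y)) :=
  hφ.smooth.comp (hf.prodMk hg)

theorem IsSmoothAction.contMDiff_orbit (hφ : IsSmoothAction φ) (x : M) :
    ContMDiff 𝓘(ℝ, Vec n) (𝓡 (n + 1)) ∞ (fun h => φ h x) :=
  hφ.contMDiff_comp contMDiff_id contMDiff_const

theorem IsSmoothAction.contMDiff_act (hφ : IsSmoothAction φ) (h : Vec n) :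
    ContMDiff (𝓡 (n + 1)) (𝓡 (n + 1)) ∞ (φ h) :=
  hφ.contMDiff_comp contMDiff_const contMDiff_id

theorem IsSmoothAction.continuous (hφ : IsSmoothAction φ) :
    Continuous (fun q : Vec n × M => φ q.1 q.2) :=
  hφ.smooth.continuous

theorem IsSmoothAction.injective_mfderiv_act (hφ : IsSmoothAction φ) (h : Vec n) (x : M) :
    Function.Injective (mfderiv (𝓡 (n + 1)) (𝓡 (n + 1)) (φ h) x) := by
  have h1 := HasMFDerivAt.comp x ((hφ.contMDiff_act (-h)).mdifferentiableAt (by simp)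
    (x := φ h x)).hasMFDerivAt ((hφ.contMDiff_act h).mdifferentiableAt (by simp)
    (x := x)).hasMFDerivAt
  have h2 : φ (-h) ∘ φ h = id := funext fun y => hφ.neg_act h y
  rw [h2] at h1
  have h3 := hasMFDerivAt_unique h1 (hasMFDerivAt_id x)
  refine Function.LeftInverse.injective
    (g := (mfderiv (𝓡 (n + 1)) (𝓡 (n + 1)) (φ (-h)) (φ h x) : Vec (n + 1) → Vec (n + 1)))
    fun v => ?_
  exact congrArg (fun L : Vec (n + 1) →L[ℝ] Vec (n + 1) => L v) h3

/-- The orbit maps of a locally free action are immersions at `0`. -/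
theorem IsLocallyFree.injective_mfderiv_orbit [T2Space M] [IsManifold (𝓡 (n + 1)) ∞ M]
    (hfree : IsLocallyFree φ) (hφ : IsSmoothAction φ) (x : M) :
    Function.Injective (mfderiv 𝓘(ℝ, Vec n) (𝓡 (n + 1)) (fun h => φ h x) 0) := by
  refine (injective_iff_map_eq_zero (mfderiv 𝓘(ℝ, Vec n) (𝓡 (n + 1)) (fun h => φ h x)
    0).toLinearMap).2 fun v hv => ?_
  change Vec n at v
  by_contra hv0
  have hd : ∀ s : ℝ, HasFDerivAt (fun r : ℝ => r • v)
      (ContinuousLinearMap.toSpanSingleton ℝ v) s := fun s =>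
    (ContinuousLinearMap.toSpanSingleton ℝ v).hasFDerivAt
  have hγ : ContMDiff 𝓘(ℝ, ℝ) (𝓡 (n + 1)) ∞ (fun s : ℝ => φ (s • v) x) :=
    hφ.contMDiff_comp (contMDiff_iff_contDiff.2 (by fun_prop)) contMDiff_const
  -- A vector in the kernel gives a one-parameter orbit with zero velocity at `0`. The action
  -- carries this to every time `s`, so the orbit is constant, against the isolation of `0` in the
  -- isotropy group.
  have h0 : ∀ s : ℝ, mfderiv 𝓘(ℝ, ℝ) (𝓡 (n + 1)) (fun s : ℝ => φ (s • v) x) s = 0 := by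
    intro s
    have h00 : (mfderiv 𝓘(ℝ, ℝ) (𝓡 (n + 1)) (fun s : ℝ => φ (s • v) x) 0 : ℝ →L[ℝ] Vec (n + 1))
        = 0 := by
      refine ContinuousLinearMap.ext fun (r : ℝ) => ?_
      have e1 := mfderiv_comp_of_hasFDerivAt (F := fun h => φ h x) (g := fun r : ℝ => r • v)
        ((hφ.contMDiff_orbit x).mdifferentiableAt (by simp)) (hd 0) r
      have e2 : ∀ w : Vec n, w = 0 → (mfderiv 𝓘(ℝ, Vec n) (𝓡 (n + 1)) (fun h => φ h x) w
          (r • v) : Vec (n + 1)) = 0 := by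
        rintro _ rfl
        have e3 : (mfderiv 𝓘(ℝ, Vec n) (𝓡 (n + 1)) (fun h => φ h x) 0 v : Vec (n + 1)) = 0 := hv
        refine (map_smul (mfderiv 𝓘(ℝ, Vec n) (𝓡 (n + 1)) (fun h => φ h x) 0) r v).trans ?_
        change r • (mfderiv 𝓘(ℝ, Vec n) (𝓡 (n + 1)) (fun h => φ h x) 0 v : Vec (n + 1)) = 0
        rw [e3, smul_zero]
      exact e1.trans (e2 _ (zero_smul ℝ v))
    have e1 : (fun r : ℝ => φ (r • v) x) = φ (s • v) ∘ (fun r : ℝ => φ ((r - s) • v) x) := by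
      funext r
      simp only [Function.comp]
      rw [← hφ.add_act, ← add_smul]
      simp
    have hs : HasMFDerivAt 𝓘(ℝ, ℝ) (𝓡 (n + 1)) (fun r : ℝ => φ ((r - s) • v) x) s
        (0 : ℝ →L[ℝ] Vec (n + 1)) := by
      have e4 : HasMFDerivAt 𝓘(ℝ, ℝ) (𝓡 (n + 1)) (fun r : ℝ => φ (r • v) x) (s - s)
        (0 : ℝ →L[ℝ] Vec (n + 1)) := by
        rw [sub_self]
        have := (hγ.mdifferentiableAt (by simp) (x := 0)).hasMFDerivAt
        rw [h00] at this
        exact this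
      have e5 := HasMFDerivAt.comp (f := fun r : ℝ => r - s) s e4 (hasMFDerivAt_iff_hasFDerivAt.2
        ((hasFDerivAt_id (𝕜 := ℝ) s).sub_const s))
      exact e5.congr_mfderiv (ContinuousLinearMap.zero_comp _)
    have h6 := HasMFDerivAt.comp s ((hφ.contMDiff_act (s • v)).mdifferentiableAt
      (by simp)).hasMFDerivAt hs
    rw [e1, h6.mfderiv]
    exact ContinuousLinearMap.comp_zero _
  obtain ⟨U, hUo, hU0, hU⟩ := hfree x
  have hcont : Continuous fun s : ℝ => s • v := by fun_prop
  obtain ⟨ε, hε, hb⟩ := Metric.isOpen_iff.1 (hUo.preimage hcont) 0 (by simpa using hU0)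
  have hmem : (ε / 2) ∈ Metric.ball (0 : ℝ) ε := by
    rw [Metric.mem_ball, dist_zero_right, Real.norm_eq_abs, abs_of_pos (by linarith)]; linarith
  have := hU _ (hb hmem) ((eq_of_mfderiv_eq_zero hγ h0 (ε / 2) 0).trans (by simp [hφ.zero_act]))
  rcases smul_eq_zero.1 this with h | h
  · linarith
  · exact hv0 h

end LocallyFreeActions

/-! ### Lifting smoothness through local diffeomorphisms -/

section LocalDiffeomorphTools

variable {m : ℕ} {M : Type*} [TopologicalSpace M] [ChartedSpace (Vec m) M]
  {E : Type*} [NormedAddCommGroup E] [NormedSpace ℝ E]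
  {E' : Type*} [NormedAddCommGroup E'] [NormedSpace ℝ E']

/-- A continuous lift of a smooth map through a local diffeomorphism is smooth. -/
theorem IsLocalDiffeomorphAt.contDiffWithinAt_of_comp {F : E → M} {g : E' → E} {s : Set E'}
    {x : E'} (hF : IsLocalDiffeomorphAt 𝓘(ℝ, E) (𝓡 m) ∞ F (g x))
    (hg : ContinuousWithinAt g s x)
    (h : ContMDiffWithinAt 𝓘(ℝ, E') (𝓡 m) ∞ (fun y => F (g y)) s x) :
    ContDiffWithinAt ℝ ∞ g s x := by
  have h1 : ContMDiffWithinAt 𝓘(ℝ, E') 𝓘(ℝ, E) ∞ (fun y => hF.localInverse (F (g y))) s x :=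
    hF.localInverse_contMDiffAt.comp_contMDiffWithinAt x h
  have h2 := hg.eventually hF.localInverse_eventuallyEq_left
  refine contMDiffWithinAt_iff_contDiffWithinAt.1 (h1.congr_of_eventuallyEq ?_ ?_)
  · exact h2.mono fun y hy => hy.symm
  · exact hF.localInverse_eventuallyEq_left.self_of_nhds.symm

theorem IsLocalDiffeomorphAt.exists_injOn {F : E → M} {x : E}
    (hF : IsLocalDiffeomorphAt 𝓘(ℝ, E) (𝓡 m) ∞ F x) : ∃ W ∈ 𝓝 x, Set.InjOn F W := by
  obtain ⟨Q, hx, hQ⟩ := hF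
  exact ⟨Q.source, Q.open_source.mem_nhds hx, Q.toPartialEquiv.injOn.congr hQ.symm⟩

end LocalDiffeomorphTools

/-! ### Flow boxes along `P` and returns to `P` -/

section FlowBox

variable {n : ℕ} {M : Type*} [TopologicalSpace M] [ChartedSpace (Vec (n + 1)) M]
  {φ : Vec n → M → M} {P : Set M} {p : ℝ → M}

/-- The action of `ℝⁿ` on the points of a parametrized transversal. -/
def flowBox (φ : Vec n → M → M) (p : ℝ → M) (q : Vec n × ℝ) : M := φ q.1 (p q.2)

theorem IsSmoothAction.contMDiff_flowBox (hφ : IsSmoothAction φ)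
    (hp : ContMDiff 𝓘(ℝ, ℝ) (𝓡 (n + 1)) ∞ p) :
    ContMDiff 𝓘(ℝ, Vec n × ℝ) (𝓡 (n + 1)) ∞ (flowBox φ p) :=
  hφ.contMDiff_comp (contMDiff_iff_contDiff.2 contDiff_fst)
    (hp.comp (contMDiff_iff_contDiff.2 contDiff_snd))

theorem IsClosedTransversal.surjective_flowBox (hP : IsClosedTransversal φ P p)
    (hφ : IsSmoothAction φ) : Function.Surjective (flowBox φ p) := by
  intro x
  obtain ⟨_, ⟨h, rfl⟩, hx⟩ := hP.total x
  rw [← hP.range_eq] at hx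
  obtain ⟨t, ht⟩ := hx
  exact ⟨(-h, t), by rw [flowBox, ht, hφ.neg_act]⟩

theorem IsClosedTransversal.mem (hP : IsClosedTransversal φ P p) (t : ℝ) : p t ∈ P :=
  hP.range_eq ▸ Set.mem_range_self t

theorem IsClosedTransversal.exists_eq (hP : IsClosedTransversal φ P p) {x : M} (hx : x ∈ P) :
    ∃ t, p t = x := by
  rwa [← hP.range_eq] at hx

section LocalFreeness

variable [T2Space M] [IsManifold (𝓡 (n + 1)) ∞ M]

/-- Transversality kills the `ℝ`-component of a kernel vector; local freeness then kills the
`ℝⁿ`-component. -/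
theorem IsClosedTransversal.injective_mfderiv_flowBox_zero (hP : IsClosedTransversal φ P p)
    (hφ : IsSmoothAction φ) (hfree : IsLocallyFree φ) (t : ℝ) :
    Function.Injective (mfderiv 𝓘(ℝ, Vec n × ℝ) (𝓡 (n + 1)) (flowBox φ p) (0, t)) := by
  refine (injective_iff_map_eq_zero (mfderiv 𝓘(ℝ, Vec n × ℝ) (𝓡 (n + 1)) (flowBox φ p)
    (0, t)).toLinearMap).2 fun (w : Vec n × ℝ) hw => ?_
  obtain ⟨v, s⟩ := w
  have h1 := mfderiv_prod_apply ((hφ.contMDiff_flowBox hP.smooth).mdifferentiableAt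
    (by simp) (x := ((0 : Vec n), t))) v s
  have hp : (fun t => flowBox φ p (0, t)) = p := funext fun t => hφ.zero_act _
  rw [hp] at h1
  have hw' : (mfderiv 𝓘(ℝ, Vec n × ℝ) (𝓡 (n + 1)) (flowBox φ p) (0, t) (v, s) : Vec (n + 1)) = 0 :=
    hw
  rw [hw'] at h1
  set A : Vec n →L[ℝ] Vec (n + 1) :=
    mfderiv 𝓘(ℝ, Vec n) (𝓡 (n + 1)) (fun k => flowBox φ p (k, t)) 0 with hA
  set u : Vec (n + 1) := velocity p t with hu
  have hs : (mfderiv 𝓘(ℝ, ℝ) (𝓡 (n + 1)) p t s : Vec (n + 1)) = s • u := by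
    have := map_smul (mfderiv 𝓘(ℝ, ℝ) (𝓡 (n + 1)) p t) s (1 : ℝ)
    have h2 : (s • (1 : ℝ) : ℝ) = s := by simp
    exact (congrArg (fun r : ℝ => (mfderiv 𝓘(ℝ, ℝ) (𝓡 (n + 1)) p t r : Vec (n + 1)))
      h2.symm).trans this
  replace h1 : 0 = A v + s • u := h1.trans (congrArg (A v + ·) hs)
  have htr : ∀ w : Vec n, A w ≠ u := fun w hw => hP.transverse t ⟨w, hw⟩
  have hs0 : s = 0 := by
    by_contra hs0
    refine htr (-(s⁻¹ • v)) ?_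
    have h3 : A v = -(s • u) := eq_neg_of_add_eq_zero_left h1.symm
    rw [map_neg, map_smul, h3, smul_neg, neg_neg, smul_smul, inv_mul_cancel₀ hs0, one_smul]
  subst hs0
  rw [zero_smul, add_zero] at h1
  have h4 : v = 0 := hfree.injective_mfderiv_orbit hφ (p t) (h1.symm.trans (map_zero A).symm)
  rw [h4]
  rfl

/-- The action by `h` moves the differential at `(0, t)` to that at `(h, t)`, so injectivity is
needed only on the slice `h = 0`. -/
theorem IsClosedTransversal.isLocalDiffeomorph_flowBox (hP : IsClosedTransversal φ P p)
    (hφ : IsSmoothAction φ) (hfree : IsLocallyFree φ) :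
    IsLocalDiffeomorph 𝓘(ℝ, Vec n × ℝ) (𝓡 (n + 1)) ∞ (flowBox φ p) := by
  refine isLocalDiffeomorph_of_injective_mfderiv (by simp) (hφ.contMDiff_flowBox hP.smooth) ?_
  rintro ⟨h, t⟩
  have hsm := hφ.contMDiff_flowBox hP.smooth
  have h1 : flowBox φ p = φ h ∘ fun q => flowBox φ p (q - (h, 0)) := by
    funext q
    simp [flowBox, ← hφ.add_act]
  have hsh : MDifferentiableAt 𝓘(ℝ, Vec n × ℝ) (𝓡 (n + 1)) (fun q => flowBox φ p (q - (h, 0)))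
      (h, t) :=
    (hsm.comp (contMDiff_iff_contDiff.2 (by fun_prop :
      ContDiff ℝ ∞ fun q : Vec n × ℝ => q - (h, 0)))).mdifferentiableAt (by simp)
  have h2 := (HasMFDerivAt.comp (h, t) ((hφ.contMDiff_act h).mdifferentiableAt
      (by simp)).hasMFDerivAt hsh.hasMFDerivAt).mfderiv
  rw [← h1] at h2
  rw [h2]
  intro v w hvw
  replace hvw := hφ.injective_mfderiv_act h _ hvw
  have e1 : ∀ v : Vec n × ℝ,
      (mfderiv 𝓘(ℝ, Vec n × ℝ) (𝓡 (n + 1)) (fun q => flowBox φ p (q - (h, 0))) (h, t) v :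
      Vec (n + 1)) = (mfderiv 𝓘(ℝ, Vec n × ℝ) (𝓡 (n + 1)) (flowBox φ p) ((h, t) - (h, 0)) v :
      Vec (n + 1)) := fun v =>
    mfderiv_comp_of_hasFDerivAt (hsm.mdifferentiableAt (by simp))
      ((hasFDerivAt_id (𝕜 := ℝ) (h, t)).sub_const (h, (0 : ℝ))) v
  have e2 : ∀ q : Vec n × ℝ, q = (0, t) →
      Function.Injective (mfderiv 𝓘(ℝ, Vec n × ℝ) (𝓡 (n + 1)) (flowBox φ p) q) := by
    rintro _ rfl
    exact hP.injective_mfderiv_flowBox_zero hφ hfree t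
  exact e2 ((h, t) - (h, 0)) (by rw [Prod.mk_sub_mk, sub_self, sub_zero]) ((e1 v).symm.trans (hvw.trans (e1 w)))

/-- Nearby points of the transversal are not related by small elements of `ℝⁿ`. -/
theorem IsClosedTransversal.exists_nhds_return (hP : IsClosedTransversal φ P p)
    (hφ : IsSmoothAction φ) (hfree : IsLocallyFree φ) {x₀ : M} (hx₀ : x₀ ∈ P) :
    ∃ U ∈ 𝓝 (0 : Vec n), ∃ V ∈ 𝓝 x₀, ∀ u ∈ U, ∀ x ∈ V, x ∈ P → φ u x ∈ V → φ u x ∈ P →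
      u = 0 := by
  obtain ⟨t, rfl⟩ := hP.exists_eq hx₀
  obtain ⟨W, hW, hinj⟩ := (hP.isLocalDiffeomorph_flowBox hφ hfree (0, t)).exists_injOn
  obtain ⟨U, hU, J, hJ, hUJ⟩ := mem_nhds_prod_iff.1 hW
  -- Embeddedness enters here: points of `P` near `p t` in `M` have parameters near `t`, so local
  -- injectivity of the flow box applies to them.
  have h1 := hP.embedded.image_mem_nhds hJ
  obtain ⟨V, hV, hVJ⟩ := mem_nhds_induced _ _ _ |>.1 h1
  have key : ∀ x ∈ V, x ∈ P → ∃ s ∈ J, p s = x := by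
    intro x hx hxP
    rw [← hP.range_eq] at hxP
    obtain ⟨s, hs, hs'⟩ := hVJ (show (⟨x, hxP⟩ : Set.range p) ∈ Subtype.val ⁻¹' V from hx)
    exact ⟨s, hs, congrArg Subtype.val hs'⟩
  refine ⟨U, hU, V, hV, fun u hu x hx hxP hy hyP => ?_⟩
  obtain ⟨s, hs, rfl⟩ := key x hx hxP
  obtain ⟨s', hs', hs2⟩ := key _ hy hyP
  have := hinj (hUJ (Set.mk_mem_prod hu hs)) (hUJ (Set.mk_mem_prod (mem_of_mem_nhds hU) hs'))
    (by rw [flowBox, flowBox, hφ.zero_act]; exact hs2.symm)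
  exact congrArg Prod.fst this

/-- The set of elements of `ℝⁿ` that carry `p t` to a point of `P`. -/
def returnSet (φ : Vec n → M → M) (P : Set M) (p : ℝ → M) (t : ℝ) : Set (Vec n) :=
  {h | φ h (p t) ∈ P}

omit [T2Space M] [IsManifold (𝓡 (n + 1)) ∞ M] in
theorem IsClosedTransversal.zero_mem_returnSet (hP : IsClosedTransversal φ P p)
    (hφ : IsSmoothAction φ) (t : ℝ) : 0 ∈ returnSet φ P p t := by
  change φ 0 (p t) ∈ P
  rw [hφ.zero_act]
  exact hP.mem t

/-- Two continuous selections of returns which agree at one point are equal. -/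
theorem IsClosedTransversal.return_unique (hP : IsClosedTransversal φ P p)
    (hφ : IsSmoothAction φ) (hfree : IsLocallyFree φ) {c d : ℝ → Vec n} (hc : Continuous c)
    (hd : Continuous d) (hcP : ∀ t, c t ∈ returnSet φ P p t)
    (hdP : ∀ t, d t ∈ returnSet φ P p t) {t₀ : ℝ} (h0 : c t₀ = d t₀) : c = d := by
  have hclosed : IsClosed {t | c t = d t} := isClosed_eq hc hd
  have hopen : IsOpen {t | c t = d t} := by
    rw [isOpen_iff_mem_nhds]
    intro t ht
    -- Near `t` the small vector `c s - d s` carries one return to the other, both near the common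
    -- point of `P`, so it vanishes.
    obtain ⟨U, hU, V, hV, hUV⟩ := hP.exists_nhds_return hφ hfree (hcP t)
    have h1 : ∀ᶠ s in 𝓝 t, c s - d s ∈ U := by
      refine (hc.sub hd).continuousAt.eventually_mem ?_
      change U ∈ 𝓝 (c t - d t)
      rwa [show c t = d t from ht, sub_self]
    have hcc : Continuous fun s => φ (c s) (p s) :=
      hφ.continuous.comp (hc.prodMk hP.smooth.continuous)
    have hdc : Continuous fun s => φ (d s) (p s) :=
      hφ.continuous.comp (hd.prodMk hP.smooth.continuous)
    have h2 : ∀ᶠ s in 𝓝 t, φ (c s) (p s) ∈ V := hcc.continuousAt.eventually_mem hV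
    have h3 : ∀ᶠ s in 𝓝 t, φ (d s) (p s) ∈ V := by
      refine hdc.continuousAt.eventually_mem ?_
      rwa [← show c t = d t from ht]
    filter_upwards [h1, h2, h3] with s hs1 hs2 hs3
    have e : φ (c s - d s) (φ (d s) (p s)) = φ (c s) (p s) := by
      rw [← hφ.add_act, sub_add_cancel]
    exact sub_eq_zero.1 (hUV _ hs1 _ hs3 (hdP s) (e ▸ hs2) (e ▸ hcP s))
  have := IsClopen.eq_univ ⟨hclosed, hopen⟩ ⟨t₀, h0⟩
  funext t
  have ht : t ∈ {t | c t = d t} := by rw [this]; trivial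
  exact ht

/-- The returns form a closed set because `P` is closed, and each is isolated by
`IsClosedTransversal.exists_nhds_return`; compactness of the ball does the rest. -/
theorem IsClosedTransversal.finite_returnSet (hP : IsClosedTransversal φ P p)
    (hφ : IsSmoothAction φ) (hfree : IsLocallyFree φ) (t : ℝ) (r : ℝ) :
    (returnSet φ P p t ∩ Metric.closedBall 0 r).Finite := by
  have hcont : Continuous fun h => φ h (p t) := (hφ.contMDiff_orbit (p t)).continuous
  have hcl : IsClosed (returnSet φ P p t) := hP.closed.preimage hcont
  have hK : IsCompact (returnSet φ P p t ∩ Metric.closedBall 0 r) :=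
    (isCompact_closedBall 0 r).inter_left hcl
  have key : ∀ h ∈ returnSet φ P p t ∩ Metric.closedBall 0 r, ∃ N ∈ 𝓝 h,
      N ∩ returnSet φ P p t ⊆ {h} := by
    intro h hh
    obtain ⟨U, hU, V, hV, hUV⟩ := hP.exists_nhds_return hφ hfree hh.1
    refine ⟨{k | k - h ∈ U} ∩ {k | φ k (p t) ∈ V}, Filter.inter_mem ?_ ?_, ?_⟩
    · have : Continuous fun k : Vec n => k - h := by fun_prop
      refine this.continuousAt.eventually_mem ?_
      simpa using hU
    · exact hcont.continuousAt.eventually_mem hV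
    · rintro k ⟨⟨hk1, hk2⟩, hk3⟩
      have e : φ (k - h) (φ h (p t)) = φ k (p t) := by
        rw [← hφ.add_act, sub_add_cancel]
      exact sub_eq_zero.1 (hUV _ hk1 _ (mem_of_mem_nhds hV) hh.1 (e ▸ hk2) (e ▸ hk3))
  choose! N hN hN' using key
  obtain ⟨s, hs, hsK⟩ := hK.elim_nhds_subcover N hN
  refine s.finite_toSet.subset fun h hh => ?_
  obtain ⟨k, hk, hk'⟩ := Set.mem_iUnion₂.1 (hsK hh)
  rw [hN' k (hs k hk) ⟨hk', hh.1⟩]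
  exact hk

omit [T2Space M] [IsManifold (𝓡 (n + 1)) ∞ M] in
-- The curve `p` is a covering of `P`: it is the quotient of `ℝ` by the discrete group `ℤT`, which
-- is trivial when `P` is a line.
theorem IsClosedTransversal.exists_lift (hP : IsClosedTransversal φ P p) {x : ℝ → M}
    (hx : Continuous x) (hxP : ∀ t, x t ∈ P) {t₀ s₀ : ℝ} (h0 : p s₀ = x t₀) :
    ∃ τ : ℝ → ℝ, Continuous τ ∧ (∀ t, p (τ t) = x t) ∧ τ t₀ = s₀ := by
  obtain ⟨T, hT⟩ := hP.fibers
  have hq : Topology.IsQuotientMap (Set.rangeFactorization p) :=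
    hP.embedded.isQuotientMap (hP.smooth.continuous.subtype_mk _) Set.rangeFactorization_surjective
  have hdisc : IsDiscrete (AddSubgroup.zmultiples T : Set ℝ) :=
    SetLike.isDiscrete_iff_discreteTopology.2 inferInstance
  have hcov := (hq.isAddQuotientCoveringMap_of_addSubgroup (AddSubgroup.zmultiples T) hdisc
    (fun {t t'} => by
      rw [AddSubgroup.mem_zmultiples_iff, Set.rangeFactorization, Set.rangeFactorization,
        Subtype.mk.injEq, hT]
      simp only [zsmul_eq_mul]
      exact exists_congr fun m => by constructor <;> intro h <;> linarith)).isCoveringMap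
  obtain ⟨F, ⟨hF1, hF2⟩, -⟩ := hcov.existsUnique_continuousMap_lifts
    (A := ℝ) ⟨fun t => (⟨x t, hP.range_eq ▸ hxP t⟩ : Set.range p), hx.subtype_mk _⟩ t₀ s₀
    (Subtype.ext h0)
  exact ⟨F, F.continuous, fun t => congrArg Subtype.val (congrFun hF2 t), hF1⟩

/-- A continuous selection of returns is smooth, and moves the parameter smoothly. -/
theorem IsClosedTransversal.exists_contDiff_lift (hP : IsClosedTransversal φ P p)
    (hφ : IsSmoothAction φ) (hfree : IsLocallyFree φ) {c : ℝ → Vec n} (hc : Continuous c)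
    (hcP : ∀ t, c t ∈ returnSet φ P p t) {t₀ s₀ : ℝ} (h0 : p s₀ = φ (c t₀) (p t₀)) :
    ContDiff ℝ ∞ c ∧ ∃ τ : ℝ → ℝ, ContDiff ℝ ∞ τ ∧ (∀ t, p (τ t) = φ (c t) (p t)) ∧
      τ t₀ = s₀ := by
  obtain ⟨τ, hτ, hpτ, hτ0⟩ := hP.exists_lift
    (hφ.continuous.comp (hc.prodMk hP.smooth.continuous)) hcP h0
  -- The curve `(-c t, τ t)` is a continuous lift of `p` itself through the flow box, a local
  -- diffeomorphism; this yields smoothness of `c` and `τ` together.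
  have hg : ContDiff ℝ ∞ fun t => (-c t, τ t) := by
    rw [contDiff_iff_contDiffAt]
    intro t
    refine contDiffWithinAt_univ.1 ((hP.isLocalDiffeomorph_flowBox hφ hfree
      _).contDiffWithinAt_of_comp (hc.neg.prodMk hτ).continuousWithinAt ?_)
    have e : (fun t => flowBox φ p (-c t, τ t)) = p := by
      funext t
      rw [flowBox, hpτ]
      exact hφ.neg_act _ _
    rw [e]
    exact hP.smooth.contMDiffAt
  refine ⟨?_, τ, hg.snd, hpτ, hτ0⟩
  simpa using hg.fst.neg

end LocalFreeness

end FlowBox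

/-! ### Adapted families and the parametrization they give -/

section AdaptedFamilies

variable {n : ℕ} {M : Type*} {φ : Vec n → M → M} {P : Set M} {p : ℝ → M} {G : ℝ → Vec n → Vec n}

/-- A smooth family `G t` of diffeomorphisms of `ℝⁿ` which fixes `0` and makes the returns of the
leaves to `P` independent of `t`, compatibly with the identifications `φ h (p t) = p t'`. -/
structure IsAdaptedFamily (φ : Vec n → M → M) (P : Set M) (p : ℝ → M)
    (G : ℝ → Vec n → Vec n) : Prop where
  contDiff : ContDiff ℝ ∞ (fun q : Vec n × ℝ => G q.2 q.1)
  injective : ∀ t, Function.Injective (G t)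
  surjective : ∀ t, Function.Surjective (G t)
  injective_fderiv : ∀ t k, Function.Injective (fderiv ℝ (G t) k)
  apply_zero : ∀ t, G t 0 = 0
  equivariant : ∀ t t' γ, φ (G t γ) (p t) = p t' → ∀ k, G t' k = G t (k + γ) - G t γ
  return_mem : ∀ t γ, G t γ ∈ returnSet φ P p t → ∀ s, G s γ ∈ returnSet φ P p s

/-- The parametrization of `M` given by an adapted family. -/
def adaptedBox (φ : Vec n → M → M) (p : ℝ → M) (G : ℝ → Vec n → Vec n) (q : Vec n × ℝ) : M :=
  flowBox φ p (G q.2 q.1, q.2)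

namespace IsAdaptedFamily

variable (hG : IsAdaptedFamily φ P p G)
include hG

theorem contDiff_slice (t : ℝ) : ContDiff ℝ ∞ (G t) :=
  hG.contDiff.comp (contDiff_prodMk_left t)

theorem contDiff_curve (k : Vec n) : ContDiff ℝ ∞ (fun t => G t k) :=
  hG.contDiff.comp (contDiff_prodMk_right k)

variable [TopologicalSpace M] [ChartedSpace (Vec (n + 1)) M]

theorem adaptedBox_zero (hφ : IsSmoothAction φ) (t : ℝ) : adaptedBox φ p G (0, t) = p t := by
  rw [adaptedBox, flowBox, hG.apply_zero, hφ.zero_act]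

theorem surjective_adaptedBox (hφ : IsSmoothAction φ) (hP : IsClosedTransversal φ P p) :
    Function.Surjective (adaptedBox φ p G) := by
  intro x
  obtain ⟨⟨h, t⟩, rfl⟩ := hP.surjective_flowBox hφ x
  obtain ⟨k, rfl⟩ := hG.surjective t h
  exact ⟨(k, t), rfl⟩

theorem contMDiff_adaptedBox (hφ : IsSmoothAction φ) (hP : IsClosedTransversal φ P p) :
    ContMDiff 𝓘(ℝ, Vec n × ℝ) (𝓡 (n + 1)) ∞ (adaptedBox φ p G) :=
  (hφ.contMDiff_flowBox hP.smooth).comp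
    (contMDiff_iff_contDiff.2 (hG.contDiff.prodMk contDiff_snd))

/-- The map `(k, t) ↦ (G t k, t)` has a block triangular differential, injective because that of `G
t` is. -/
theorem isLocalDiffeomorph [T2Space M] [IsManifold (𝓡 (n + 1)) ∞ M] (hφ : IsSmoothAction φ)
    (hfree : IsLocallyFree φ) (hP : IsClosedTransversal φ P p) :
    IsLocalDiffeomorph 𝓘(ℝ, Vec n × ℝ) (𝓡 (n + 1)) ∞ (adaptedBox φ p G) := by
  refine isLocalDiffeomorph_of_injective_mfderiv (by simp) (hG.contMDiff_adaptedBox hφ hP) ?_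
  rintro ⟨k, t⟩
  have hL := hP.isLocalDiffeomorph_flowBox hφ hfree
  have hd := (hG.contDiff.differentiable (by simp)).differentiableAt (x := (k, t))
  have hg := hd.hasFDerivAt.prodMk (hasFDerivAt_snd (𝕜 := ℝ) (p := (k, t)))
  intro v w hvw
  have e1 := fun v => mfderiv_comp_of_hasFDerivAt
    (((hφ.contMDiff_flowBox hP.smooth)).mdifferentiableAt (by simp)) hg v
  have e2 := ((hL _).mfderivToContinuousLinearEquiv (by simp)).injective
    ((e1 v).symm.trans (hvw.trans (e1 w)))
  obtain ⟨v₁, v₂⟩ : Vec n × ℝ := v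
  obtain ⟨w₁, w₂⟩ : Vec n × ℝ := w
  have e3 : v₂ = w₂ := congrArg Prod.snd e2
  have e4 : fderiv ℝ (fun q : Vec n × ℝ => G q.2 q.1) (k, t) (v₁, v₂) =
    fderiv ℝ (fun q : Vec n × ℝ => G q.2 q.1) (k, t) (w₁, w₂) := congrArg Prod.fst e2
  have e5 : ∀ u, fderiv ℝ (G t) k u = fderiv ℝ (fun q : Vec n × ℝ => G q.2 q.1) (k, t) (u, 0) := by
    intro u
    have := (hd.hasFDerivAt.comp k (hasFDerivAt_prodMk_left (𝕜 := ℝ) k t)).fderiv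
    exact congrArg (fun L : Vec n →L[ℝ] Vec n => L u) this
  subst e3
  have e6 : v₁ = w₁ := by
    refine hG.injective_fderiv t k ?_
    rw [e5, e5, ← sub_eq_zero, ← map_sub, Prod.mk_sub_mk, sub_self]
    rw [← sub_eq_zero, ← map_sub, Prod.mk_sub_mk, sub_self] at e4
    exact e4
  rw [e6]

/-- Identifications of the parametrization are invariant under translations. -/
theorem exists_transport (hφ : IsSmoothAction φ) {k k' : Vec n} {t t' : ℝ}
    (h : adaptedBox φ p G (k, t) = adaptedBox φ p G (k', t')) :
    φ (G t (k - k')) (p t) = p t' ∧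
      ∀ l, adaptedBox φ p G (k + l, t) = adaptedBox φ p G (k' + l, t') := by
  -- The vector `G t k - G t' k'` carries `p t` to `p t'`. Equivariance evaluated at `k'` then
  -- identifies its label `γ` as `k - k'`.
  obtain ⟨γ, hγ⟩ := hG.surjective t (G t k - G t' k')
  have h1 : φ (G t γ) (p t) = p t' := by
    rw [hγ, sub_eq_neg_add, hφ.add_act]
    exact (congrArg (φ (-G t' k')) h).trans (hφ.neg_act _ _)
  have h2 := hG.equivariant t t' γ h1
  have h3 : k' + γ = k := by
    refine hG.injective t ?_
    have := h2 k'
    rw [hγ] at this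
    rw [eq_sub_iff_add_eq] at this
    rw [← this]
    abel
  refine ⟨by rwa [← h3, add_sub_cancel_left], fun l => ?_⟩
  simp only [adaptedBox, flowBox]
  rw [← h1, ← hφ.add_act, h2, sub_add_cancel, ← h3]
  congr 2
  abel

/-- An identification of two points propagates along their whole lines: the label `k - k'` is a
return at `t`, hence at every `s`, and `τ` lifts the curve of return points to the parameter of `P`.
These maps are the deck transformations. -/
theorem exists_transport_curve [T2Space M] [IsManifold (𝓡 (n + 1)) ∞ M]
    (hφ : IsSmoothAction φ) (hfree : IsLocallyFree φ)
    (hP : IsClosedTransversal φ P p) {k k' : Vec n} {t t' : ℝ}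
    (h : adaptedBox φ p G (k, t) = adaptedBox φ p G (k', t')) :
    ∃ τ : ℝ → ℝ, ContDiff ℝ ∞ τ ∧ τ t = t' ∧
      ∀ s l, adaptedBox φ p G (k + l, s) = adaptedBox φ p G (k' + l, τ s) := by
  obtain ⟨h1, -⟩ := hG.exists_transport hφ h
  have h2 := hG.return_mem t (k - k') (show φ (G t (k - k')) (p t) ∈ P from h1 ▸ hP.mem t')
  obtain ⟨-, τ, hτ, hpτ, hτt⟩ := hP.exists_contDiff_lift hφ hfree
    (hG.contDiff_curve (k - k')).continuous h2 h1.symm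
  refine ⟨τ, hτ, hτt, fun s l => ?_⟩
  have h3 : adaptedBox φ p G (k - k', s) = adaptedBox φ p G (0, τ s) := by
    rw [hG.adaptedBox_zero hφ, hpτ]
    rfl
  have := (hG.exists_transport hφ h3).2 (k' + l)
  rwa [zero_add, ← add_assoc, sub_add_cancel] at this

theorem leaf_adaptedBox (hφ : IsSmoothAction φ) (k : Vec n) (t : ℝ) :
    leaf φ (adaptedBox φ p G (k, t)) = Set.range (fun l => adaptedBox φ p G (l, t)) := by
  ext x
  constructor
  · rintro ⟨h, rfl⟩
    obtain ⟨l, hl⟩ := hG.surjective t (h + G t k)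
    exact ⟨l, by simp only [adaptedBox, flowBox, hl, hφ.add_act]⟩
  · rintro ⟨l, rfl⟩
    refine ⟨G t l - G t k, ?_⟩
    simp only [adaptedBox, flowBox]
    rw [← hφ.add_act, sub_add_cancel]

end IsAdaptedFamily

end AdaptedFamilies

/-! ### The new action and its invariant line field -/

section NewAction

variable {n : ℕ} {M : Type*} [TopologicalSpace M] [ChartedSpace (Vec (n + 1)) M]
  {φ : Vec n → M → M} {P : Set M} {p : ℝ → M} {G : ℝ → Vec n → Vec n}

/-- Translation in the first factor of `ℝⁿ × ℝ`, transported to `M` by `Ψ`. -/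
noncomputable def pushAction (Ψ : Vec n × ℝ → M) (h : Vec n) (x : M) : M :=
  Ψ ((Function.invFun Ψ x).1 + h, (Function.invFun Ψ x).2)

/-- The derivative of `Ψ` in the direction of the second factor of `ℝⁿ × ℝ`. -/
noncomputable def boxDirection (Ψ : Vec n × ℝ → M) (q : Vec n × ℝ) : Vec (n + 1) :=
  mfderiv 𝓘(ℝ, Vec n × ℝ) (𝓡 (n + 1)) Ψ q ((0, 1) : Vec n × ℝ)

/-- The direction of the second factor of `ℝⁿ × ℝ`, transported to `M` by `Ψ`. -/
noncomputable def pushField (Ψ : Vec n × ℝ → M) (x : M) :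
    Submodule ℝ (TangentSpace (𝓡 (n + 1)) x) :=
  (Submodule.span ℝ {boxDirection Ψ (Function.invFun Ψ x)} : Submodule ℝ (Vec (n + 1)))

namespace IsAdaptedFamily

variable (hG : IsAdaptedFamily φ P p G)
include hG

/-- The preimage chosen by `Function.invFun` is irrelevant, because identifications of the
parametrization commute with translations in `k`. -/
theorem pushAction_apply (hφ : IsSmoothAction φ) (h : Vec n) (q : Vec n × ℝ) :
    pushAction (adaptedBox φ p G) h (adaptedBox φ p G q) = adaptedBox φ p G (q.1 + h, q.2) := by
  exact (hG.exists_transport hφ (Function.invFun_eq (f := adaptedBox φ p G) ⟨q, rfl⟩)).2 h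

theorem leaf_pushAction (hφ : IsSmoothAction φ) (hP : IsClosedTransversal φ P p) (x : M) :
    leaf (pushAction (adaptedBox φ p G)) x = leaf φ x := by
  obtain ⟨⟨k, t⟩, rfl⟩ := hG.surjective_adaptedBox hφ hP x
  rw [hG.leaf_adaptedBox hφ]
  ext x
  constructor
  · rintro ⟨h, rfl⟩
    exact ⟨k + h, (hG.pushAction_apply hφ h (k, t)).symm⟩
  · rintro ⟨l, rfl⟩
    exact ⟨l - k, (hG.pushAction_apply hφ (l - k) (k, t)).trans (by simp)⟩

/-- Points of `P` have label `0`, so `h` moves `p t` to the point labelled `(h, t)`, and being a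
return does not depend on `t`. The reverse inclusion is the same argument for `-h`. -/
theorem isInvariantTransversal (hφ : IsSmoothAction φ) (hP : IsClosedTransversal φ P p) :
    IsInvariantTransversal (pushAction (adaptedBox φ p G)) P := by
  have key : ∀ (h : Vec n) (t : ℝ), adaptedBox φ p G (h, t) ∈ P →
      ∀ s, adaptedBox φ p G (h, s) ∈ P := fun h t ht s => hG.return_mem t h ht s
  have hp : ∀ (h : Vec n) (t : ℝ), pushAction (adaptedBox φ p G) h (p t) =
      adaptedBox φ p G (h, t) := by
    intro h t
    rw [← hG.adaptedBox_zero hφ t, hG.pushAction_apply hφ, zero_add]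
  rintro h ⟨_, ⟨x, hx, rfl⟩, hy⟩
  obtain ⟨t, rfl⟩ := hP.exists_eq hx
  rw [hp] at hy
  obtain ⟨t', ht'⟩ := hP.exists_eq hy
  refine Set.Subset.antisymm ?_ ?_
  · rintro _ ⟨x, hx, rfl⟩
    obtain ⟨s, rfl⟩ := hP.exists_eq hx
    rw [hp]
    exact key h t hy s
  · intro y hy
    obtain ⟨s, rfl⟩ := hP.exists_eq hy
    have h1 : adaptedBox φ p G (h, t) = adaptedBox φ p G (0, t') := by
      rw [hG.adaptedBox_zero hφ, ht']
    have h2 := (hG.exists_transport hφ h1).2 (-h)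
    rw [add_neg_cancel, zero_add, hG.adaptedBox_zero hφ] at h2
    have h3 := key (-h) t' (h2 ▸ hP.mem t) s
    refine ⟨_, h3, ?_⟩
    rw [hG.pushAction_apply hφ, neg_add_cancel, hG.adaptedBox_zero hφ]

section Smooth

variable [T2Space M] [IsManifold (𝓡 (n + 1)) ∞ M]

/-- For smoothness, the chosen preimage, which need not vary continuously, is replaced by a smooth
local inverse; the result is the same by `pushAction_apply`. -/
theorem isSmoothAction_pushAction (hφ : IsSmoothAction φ) (hfree : IsLocallyFree φ)
    (hP : IsClosedTransversal φ P p) : IsSmoothAction (pushAction (adaptedBox φ p G)) where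
  zero_act x := by
    obtain ⟨q, rfl⟩ := hG.surjective_adaptedBox hφ hP x
    rw [hG.pushAction_apply hφ, add_zero]
  add_act h k x := by
    obtain ⟨q, rfl⟩ := hG.surjective_adaptedBox hφ hP x
    rw [hG.pushAction_apply hφ, hG.pushAction_apply hφ, hG.pushAction_apply hφ, add_assoc,
      add_comm h]
  smooth := by
    rintro ⟨h, x⟩
    obtain ⟨q, rfl⟩ := hG.surjective_adaptedBox hφ hP x
    have hL := hG.isLocalDiffeomorph hφ hfree hP q
    have h1 : ContMDiffAt (𝓘(ℝ, Vec n).prod (𝓡 (n + 1))) 𝓘(ℝ, Vec n × ℝ) ∞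
        (fun y : Vec n × M => ((hL.localInverse y.2).1 + y.1, (hL.localInverse y.2).2))
        (h, adaptedBox φ p G q) := by
      have h2 : ContMDiffAt (𝓘(ℝ, Vec n).prod (𝓡 (n + 1))) 𝓘(ℝ, Vec n × ℝ) ∞
          (fun y : Vec n × M => hL.localInverse y.2) (h, adaptedBox φ p G q) :=
        ContMDiffAt.comp (h, adaptedBox φ p G q) hL.localInverse_contMDiffAt contMDiffAt_snd
      have h3 : ContMDiffAt (𝓘(ℝ, Vec n).prod (𝓡 (n + 1))) 𝓘(ℝ, Vec n) ∞
          (fun y : Vec n × M => y.1) (h, adaptedBox φ p G q) := contMDiffAt_fst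
      have h4 : ContDiff ℝ ∞ fun z : (Vec n × ℝ) × Vec n => (z.1.1 + z.2, z.1.2) := by fun_prop
      exact ContMDiffAt.comp (h, adaptedBox φ p G q)
        (g := fun z : (Vec n × ℝ) × Vec n => (z.1.1 + z.2, z.1.2))
        (contMDiff_iff_contDiff.2 h4).contMDiffAt (h2.prodMk_space h3)
    refine ((hG.contMDiff_adaptedBox hφ hP).contMDiffAt.comp _ h1).congr_of_eventuallyEq ?_
    have h5 : ∀ᶠ y in 𝓝 (adaptedBox φ p G q), adaptedBox φ p G (hL.localInverse y) = y :=
      hL.localInverse_eventuallyEq_right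
    filter_upwards [(continuous_snd (X := Vec n)).continuousAt.eventually h5] with y hy
    simp only [Function.comp]
    rw [← hG.pushAction_apply hφ, hy]

theorem isLocallyFree_pushAction (hφ : IsSmoothAction φ) (hfree : IsLocallyFree φ)
    (hP : IsClosedTransversal φ P p) : IsLocallyFree (pushAction (adaptedBox φ p G)) := by
  intro x
  obtain ⟨⟨k, t⟩, rfl⟩ := hG.surjective_adaptedBox hφ hP x
  obtain ⟨W, hW, hinj⟩ := (hG.isLocalDiffeomorph hφ hfree hP (k, t)).exists_injOn
  have hc : Continuous fun h : Vec n => (k + h, t) := by fun_prop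
  refine ⟨(fun h : Vec n => (k + h, t)) ⁻¹' interior W, isOpen_interior.preimage hc, ?_, ?_⟩
  · simpa using mem_interior_iff_mem_nhds.2 hW
  · intro h hh hx
    rw [hG.pushAction_apply hφ] at hx
    have := hinj (interior_subset hh) (mem_of_mem_nhds hW) hx
    simpa using congrArg Prod.fst this

omit [T2Space M] [IsManifold (𝓡 (n + 1)) ∞ M] in
theorem boxDirection_eq (hφ : IsSmoothAction φ) (hP : IsClosedTransversal φ P p)
    (k : Vec n) (t : ℝ) : boxDirection (adaptedBox φ p G) (k, t) =
      (mfderiv 𝓘(ℝ, ℝ) (𝓡 (n + 1)) (fun s => adaptedBox φ p G (k, s)) t (1 : ℝ) : Vec (n + 1)) :=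
  (mfderiv_comp_of_hasFDerivAt (g := fun s : ℝ => (k, s))
    ((hG.contMDiff_adaptedBox hφ hP).mdifferentiableAt (by simp))
    (hasFDerivAt_prodMk_right (𝕜 := ℝ) k t) 1).symm

theorem boxDirection_ne_zero (hφ : IsSmoothAction φ) (hfree : IsLocallyFree φ)
    (hP : IsClosedTransversal φ P p) (q : Vec n × ℝ) :
    boxDirection (adaptedBox φ p G) q ≠ 0 := by
  intro h0
  have := ((hG.isLocalDiffeomorph hφ hfree hP q).mfderivToContinuousLinearEquiv
    (by simp)).injective (h0.trans (map_zero (mfderiv 𝓘(ℝ, Vec n × ℝ) (𝓡 (n + 1))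
      (adaptedBox φ p G) q)).symm)
  exact one_ne_zero (congrArg Prod.snd (this : ((0, 1) : Vec n × ℝ) = 0))

/-- Two lines through preimages of the same point have images that are reparametrizations `τ` of
each other, and `τ` has nonzero derivative because `boxDirection` never vanishes. Hence they span
the same line. -/
theorem pushField_apply (hφ : IsSmoothAction φ) (hfree : IsLocallyFree φ)
    (hP : IsClosedTransversal φ P p) (q : Vec n × ℝ) :
    pushField (adaptedBox φ p G) (adaptedBox φ p G q) =
      (Submodule.span ℝ {boxDirection (adaptedBox φ p G) q} : Submodule ℝ (Vec (n + 1))) := by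
  have hsm := hG.contMDiff_adaptedBox hφ hP
  rw [pushField]
  have hq' : adaptedBox φ p G (Function.invFun (adaptedBox φ p G) (adaptedBox φ p G q)) =
    adaptedBox φ p G q := Function.invFun_eq ⟨q, rfl⟩
  generalize Function.invFun (adaptedBox φ p G) (adaptedBox φ p G q) = q' at hq' ⊢
  obtain ⟨k, t⟩ := q
  obtain ⟨k', t'⟩ := q'
  obtain ⟨τ, hτ, rfl, hτ'⟩ := hG.exists_transport_curve hφ hfree hP hq'
  have e0 : (fun s => adaptedBox φ p G (k', s)) = fun s => adaptedBox φ p G (k, τ s) := by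
    funext s
    simpa using hτ' s 0
  have e1 := hG.boxDirection_eq hφ hP k' t'
  have hτd : HasDerivAt τ (deriv τ t') t' :=
    ((hτ.differentiable (by simp)) t').hasDerivAt
  have e2 := mfderiv_comp_of_hasFDerivAt (g := fun s : ℝ => (k, τ s))
    (hsm.mdifferentiableAt (by simp))
    ((hasFDerivAt_const k t').prodMk hτd.hasFDerivAt) 1
  rw [e0] at e1
  have e4 : (((0 : ℝ →L[ℝ] Vec n).prod
      (ContinuousLinearMap.toSpanSingleton ℝ (deriv τ t'))) 1 : Vec n × ℝ) =
      deriv τ t' • ((0, 1) : Vec n × ℝ) := by simp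
  have e6 : boxDirection (adaptedBox φ p G) (k', t') =
      deriv τ t' • boxDirection (adaptedBox φ p G) (k, τ t') :=
    e1.trans (e2.trans ((congrArg (fun w : Vec n × ℝ => (mfderiv 𝓘(ℝ, Vec n × ℝ) (𝓡 (n + 1))
      (adaptedBox φ p G) (k, τ t') w : Vec (n + 1))) e4).trans (map_smul (mfderiv
      𝓘(ℝ, Vec n × ℝ) (𝓡 (n + 1)) (adaptedBox φ p G) (k, τ t')) _ _)))
  have e7 : deriv τ t' ≠ 0 := fun h0 => hG.boxDirection_ne_zero hφ hfree hP (k', t')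
    (by rw [e6, h0, zero_smul])
  rw [e6]
  exact Submodule.span_singleton_smul_eq (IsUnit.mk0 _ e7) _

/-- The field of directions is smooth. -/
theorem exists_smooth_section (hφ : IsSmoothAction φ) (hfree : IsLocallyFree φ)
    (hP : IsClosedTransversal φ P p) (x : M) :
    ∃ (U : Set M) (X : ∀ y : M, TangentSpace (𝓡 (n + 1)) y), IsOpen U ∧ x ∈ U ∧
      ContMDiffOn (𝓡 (n + 1)) (𝓡 (n + 1)).tangent ∞
        (fun y => (⟨y, X y⟩ : TangentBundle (𝓡 (n + 1)) M)) U ∧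
      ∀ y ∈ U, pushField (adaptedBox φ p G) y = Submodule.span ℝ {X y} := by
  obtain ⟨q, rfl⟩ := hG.surjective_adaptedBox hφ hP x
  have hL := hG.isLocalDiffeomorph hφ hfree hP q
  refine ⟨hL.localInverse.source, fun y => boxDirection (adaptedBox φ p G) (hL.localInverse y),
    hL.localInverse_open_source, hL.localInverse_mem_source, ?_, ?_⟩
  · have h1 : ContMDiff 𝓘(ℝ, Vec n × ℝ) 𝓘(ℝ, Vec n × ℝ).tangent ∞
        (fun e : Vec n × ℝ => (⟨e, ((0, 1) : Vec n × ℝ)⟩ :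
          TangentBundle 𝓘(ℝ, Vec n × ℝ) (Vec n × ℝ))) := by
      rw [← contMDiffOn_univ]
      exact contMDiffOn_vectorSpace_iff_contDiffOn.2 contDiff_const.contDiffOn
    have h2 := (hG.contMDiff_adaptedBox hφ hP).contMDiff_tangentMap (m := ∞) le_rfl
    refine ((h2.comp h1).comp_contMDiffOn hL.localInverse_contMDiffOn).congr fun y hy => ?_
    -- The base point is recovered from the local inverse only up to a propositional equality, along
    -- which the vector must be transported.
    have key : ∀ (y' : M) (v : Vec (n + 1)), y' = y →
        (⟨y, v⟩ : TangentBundle (𝓡 (n + 1)) M) = ⟨y', v⟩ := by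
      rintro _ v rfl
      rfl
    exact key _ _ (hL.localInverse_right_inv hy)
  · intro y hy
    have := hG.pushField_apply hφ hfree hP (hL.localInverse y)
    rwa [hL.localInverse_right_inv hy] at this

theorem isInvariantField (hφ : IsSmoothAction φ) (hfree : IsLocallyFree φ)
    (hP : IsClosedTransversal φ P p) :
    IsInvariantField (pushAction (adaptedBox φ p G)) (pushField (adaptedBox φ p G)) := by
  intro h x
  obtain ⟨⟨k, t⟩, rfl⟩ := hG.surjective_adaptedBox hφ hP x
  have hψ := (hG.isSmoothAction_pushAction hφ hfree hP).contMDiff_act h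
  have hsm := hG.contMDiff_adaptedBox hφ hP
  have e1 := hG.boxDirection_eq hφ hP (k + h) t
  have e2 : (fun s => adaptedBox φ p G (k + h, s)) =
      pushAction (adaptedBox φ p G) h ∘ fun s => adaptedBox φ p G (k, s) := by
    funext s
    exact (hG.pushAction_apply hφ h (k, s)).symm
  have hc : ContMDiff 𝓘(ℝ, ℝ) (𝓡 (n + 1)) ∞ (fun s => adaptedBox φ p G (k, s)) :=
    hsm.comp (contMDiff_iff_contDiff.2 (contDiff_prodMk_right k))
  have e3 := (HasMFDerivAt.comp t (hψ.mdifferentiableAt (by simp)).hasMFDerivAt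
    (hc.mdifferentiableAt (by simp) (x := t)).hasMFDerivAt).mfderiv
  rw [← e2] at e3
  have e4 : boxDirection (adaptedBox φ p G) (k + h, t) = (mfderiv (𝓡 (n + 1)) (𝓡 (n + 1))
      (pushAction (adaptedBox φ p G) h) (adaptedBox φ p G (k, t))
      (boxDirection (adaptedBox φ p G) (k, t)) : Vec (n + 1)) := by
    rw [hG.boxDirection_eq hφ hP k t]
    exact e1.trans (congrArg (fun L : ℝ →L[ℝ] Vec (n + 1) => L 1) e3)
  rw [hG.pushAction_apply hφ, hG.pushField_apply hφ hfree hP, hG.pushField_apply hφ hfree hP, e4]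
  have e5 : ∀ (L : Vec (n + 1) →L[ℝ] Vec (n + 1)) (b : Vec (n + 1)),
      (Submodule.span ℝ {b}).map L.toLinearMap = Submodule.span ℝ {L b} := fun L b => by
    rw [Submodule.map_span, Set.image_singleton]
    rfl
  exact e5 _ _

theorem pushField_transversal (hφ : IsSmoothAction φ) (hfree : IsLocallyFree φ)
    (hP : IsClosedTransversal φ P p) (t : ℝ) :
    pushField (adaptedBox φ p G) (p t) = Submodule.span ℝ {velocity p t} := by
  have h1 := hG.pushField_apply hφ hfree hP (0, t)
  rw [hG.boxDirection_eq hφ hP, funext (hG.adaptedBox_zero hφ)] at h1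
  have h2 : ∀ x y : M, x = y → (pushField (adaptedBox φ p G) x : Submodule ℝ (Vec (n + 1))) =
      pushField (adaptedBox φ p G) y := by
    rintro x _ rfl
    rfl
  exact (h2 _ _ (hG.adaptedBox_zero hφ t).symm).trans h1

omit [T2Space M] [IsManifold (𝓡 (n + 1)) ∞ M] in
-- Within a leaf the parametrization is the orbit map precomposed with `l ↦ G t l - G t k`, whose
-- differential at `k` is onto; so the differentials at `k` and at `0` have the same image.
theorem mem_leafTangent_iff (hφ : IsSmoothAction φ) (hP : IsClosedTransversal φ P p)
    (k : Vec n) (t : ℝ) (w : Vec (n + 1)) :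
    w ∈ leafTangent φ (adaptedBox φ p G (k, t)) ↔ ∃ v : Vec n,
      (mfderiv 𝓘(ℝ, Vec n × ℝ) (𝓡 (n + 1)) (adaptedBox φ p G) (k, t) ((v, 0) : Vec n × ℝ) :
        Vec (n + 1)) = w := by
  have hsm := hG.contMDiff_adaptedBox hφ hP
  have e0 : ∀ v : Vec n, (mfderiv 𝓘(ℝ, Vec n) (𝓡 (n + 1)) (fun l => adaptedBox φ p G (l, t)) k v :
      Vec (n + 1)) = (mfderiv 𝓘(ℝ, Vec n × ℝ) (𝓡 (n + 1)) (adaptedBox φ p G) (k, t)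
      ((v, 0) : Vec n × ℝ) : Vec (n + 1)) := fun v =>
    mfderiv_comp_of_hasFDerivAt (hsm.mdifferentiableAt (by simp))
      (hasFDerivAt_prodMk_left (𝕜 := ℝ) k t) v
  have hd := ((hG.contDiff_slice t).differentiable (by simp) k).hasFDerivAt.sub_const (G t k)
  have e1 : ∀ v : Vec n, (mfderiv 𝓘(ℝ, Vec n) (𝓡 (n + 1)) (fun l => adaptedBox φ p G (l, t)) k v :
      Vec (n + 1)) = (mfderiv 𝓘(ℝ, Vec n) (𝓡 (n + 1)) (fun h => φ h (adaptedBox φ p G (k, t))) 0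
      (fderiv ℝ (G t) k v) : Vec (n + 1)) := by
    intro v
    have e2 : (fun l => adaptedBox φ p G (l, t)) =
        fun l => φ (G t l - G t k) (adaptedBox φ p G (k, t)) := by
      funext l
      simp only [adaptedBox, flowBox]
      rw [← hφ.add_act, sub_add_cancel]
    have e3 := mfderiv_comp_of_hasFDerivAt (F := fun h => φ h (adaptedBox φ p G (k, t)))
      ((hφ.contMDiff_orbit _).mdifferentiableAt (by simp)) hd v
    have e4 : ∀ h : Vec n, h = 0 → (mfderiv 𝓘(ℝ, Vec n) (𝓡 (n + 1))
        (fun h => φ h (adaptedBox φ p G (k, t))) h (fderiv ℝ (G t) k v) : Vec (n + 1)) =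
        (mfderiv 𝓘(ℝ, Vec n) (𝓡 (n + 1)) (fun h => φ h (adaptedBox φ p G (k, t))) 0
        (fderiv ℝ (G t) k v) : Vec (n + 1)) := by
      rintro _ rfl
      rfl
    rw [e2]
    exact e3.trans (e4 _ (sub_self _))
  have hs : Function.Surjective (fderiv ℝ (G t) k) :=
    LinearMap.surjective_of_injective (f := (fderiv ℝ (G t) k).toLinearMap)
      (hG.injective_fderiv t k)
  constructor
  · rintro ⟨v, hv⟩
    obtain ⟨u, rfl⟩ := hs v
    exact ⟨u, (e0 u).symm.trans ((e1 u).trans hv)⟩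
  · rintro ⟨v, hv⟩
    exact ⟨fderiv ℝ (G t) k v, (e1 v).symm.trans ((e0 v).trans hv)⟩

theorem isCompl_pushField (hφ : IsSmoothAction φ) (hfree : IsLocallyFree φ)
    (hP : IsClosedTransversal φ P p) (x : M) :
    IsCompl (leafTangent φ x) (pushField (adaptedBox φ p G) x) := by
  obtain ⟨⟨k, t⟩, rfl⟩ := hG.surjective_adaptedBox hφ hP x
  rw [hG.pushField_apply hφ hfree hP]
  set A : Vec n × ℝ →L[ℝ] Vec (n + 1) :=
    mfderiv 𝓘(ℝ, Vec n × ℝ) (𝓡 (n + 1)) (adaptedBox φ p G) (k, t) with hA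
  have hAi : Function.Injective A := ((hG.isLocalDiffeomorph hφ hfree hP
    (k, t)).mfderivToContinuousLinearEquiv (by simp)).injective
  have hAs : Function.Surjective A := ((hG.isLocalDiffeomorph hφ hfree hP
    (k, t)).mfderivToContinuousLinearEquiv (by simp)).surjective
  have hb : ∀ r : ℝ, r • boxDirection (adaptedBox φ p G) (k, t) = A (0, r) := fun r => by
    change r • A (0, 1) = _
    rw [← map_smul]
    simp
  have hm : ∀ w : Vec (n + 1), w ∈ leafTangent φ (adaptedBox φ p G (k, t)) ↔
      ∃ v : Vec n, A (v, 0) = w := hG.mem_leafTangent_iff hφ hP k t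
  have hm' : ∀ w : Vec (n + 1), w ∈ (Submodule.span ℝ {boxDirection (adaptedBox φ p G) (k, t)} :
      Submodule ℝ (Vec (n + 1))) ↔ ∃ r : ℝ, A (0, r) = w := fun w => by
    rw [Submodule.mem_span_singleton]
    simp only [hb]
  constructor
  · refine Submodule.disjoint_def.2 fun w hw hw' => ?_
    obtain ⟨v, hv⟩ := (hm w).1 hw
    obtain ⟨r, hr⟩ := (hm' w).1 hw'
    have := hAi (hv.trans hr.symm)
    have hr0 : (0 : ℝ) = r := congrArg Prod.snd this
    rw [← hr0] at hr
    exact hr.symm.trans (map_zero A)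
  · refine codisjoint_iff_le_sup.2 fun w _ => ?_
    obtain ⟨⟨v, r⟩, rfl⟩ := hAs w
    refine Submodule.mem_sup.2 ⟨A (v, 0), (hm _).2 ⟨v, rfl⟩, A (0, r), (hm' _).2 ⟨r, rfl⟩, ?_⟩
    refine (map_add A (v, 0) (0, r)).symm.trans ?_
    simp

end Smooth

end IsAdaptedFamily

end NewAction

/-! ### Coverings and lifts of piecewise smooth curves -/

/-- A surjective local homeomorphism whose fibers are permuted transitively by continuous maps over
the base is a covering map. -/
theorem IsLocalHomeomorph.isCoveringMap_of_transitive {E X : Type*} [TopologicalSpace E]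
    [TopologicalSpace X] [T2Space E] [PreconnectedSpace E] {F : E → X}
    (hF : IsLocalHomeomorph F) (hs : Function.Surjective F)
    (htr : ∀ e e', F e = F e' → ∃ g : E → E, Continuous g ∧ (∀ x, F (g x) = F x) ∧ g e = e') :
    IsCoveringMap F := by
  have huniq : ∀ g : E → E, Continuous g → (∀ x, F (g x) = F x) → ∀ e, g e = e → ∀ x, g x = x := by
    intro g hg hFg e he x
    exact congrFun ((T2Space.isSeparatedMap F).eq_of_comp_eq hF.isLocallyInjective hg continuous_id
      (funext hFg) e he) x
  -- This is the deck group. By uniqueness of lifts over the connected space `E`, an element with a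
  -- fixed point is the identity, and a neighbourhood on which `F` is injective is disjoint from its
  -- other translates.
  let S : Subgroup (Equiv.Perm E) :=
    { carrier := {g | Continuous g ∧ Continuous g.symm ∧ ∀ x, F (g x) = F x}
      mul_mem' := fun {g h} hg hh => ⟨hg.1.comp hh.1, hh.2.1.comp hg.2.1, fun x =>
        (hg.2.2 (h x)).trans (hh.2.2 x)⟩
      one_mem' := ⟨continuous_id, continuous_id, fun _ => rfl⟩
      inv_mem' := fun {g} hg => ⟨hg.2.1, hg.1, fun x => by
        have := hg.2.2 (g.symm x)
        rw [Equiv.apply_symm_apply] at this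
        exact this.symm⟩ }
  have hS : ∀ g : S, Continuous (g : Equiv.Perm E) ∧ ∀ x, F ((g : Equiv.Perm E) x) = F x :=
    fun g => ⟨g.2.1, g.2.2.2⟩
  have hq : IsQuotientCoveringMap F S :=
    { toIsQuotientMap := hF.isOpenMap.isQuotientMap hF.continuous hs
      continuous_const_smul := fun g => (hS g).1
      apply_eq_iff_mem_orbit := by
        intro e₁ e₂
        constructor
        · intro h
          obtain ⟨g, hg, hgF, hge⟩ := htr e₂ e₁ h.symm
          obtain ⟨g', hg', hgF', hge'⟩ := htr e₁ e₂ h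
          let G : Equiv.Perm E := ⟨g, g',
            huniq _ (hg'.comp hg) (fun x => (hgF' _).trans (hgF _)) e₂ (by simp [hge, hge']),
            huniq _ (hg.comp hg') (fun x => (hgF _).trans (hgF' _)) e₁ (by simp [hge, hge'])⟩
          exact ⟨⟨G, hg, hg', hgF⟩, hge⟩
        · rintro ⟨g, rfl⟩
          exact (hS g).2 e₂
      disjoint := by
        intro e
        obtain ⟨U, hU, heU, hinj⟩ := hF.isLocallyInjective e
        refine ⟨U, hU.mem_nhds heU, ?_⟩
        rintro g ⟨_, ⟨u, hu, rfl⟩, hgu⟩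
        have h1 : (g : Equiv.Perm E) u = u := hinj hgu hu ((hS g).2 u)
        exact Subtype.ext (Equiv.ext (huniq _ (hS g).1 (hS g).2 u h1)) }
  exact hq.isCoveringMap

theorem IsCoveringMap.exists_lift_Icc {E X : Type*} [TopologicalSpace E] [TopologicalSpace X]
    {F : E → X} (hF : IsCoveringMap F) {γ : ℝ → X} (hγ : ContinuousOn γ (Set.Icc 0 1)) {e : E}
    (he : F e = γ 0) :
    ∃ Γ : ℝ → E, Continuous Γ ∧ Γ 0 = e ∧ ∀ t ∈ Set.Icc (0 : ℝ) 1, F (Γ t) = γ t := by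
  obtain ⟨L, hL, hL0⟩ := hF.exists_path_lifts
    ⟨(Set.Icc (0 : ℝ) 1).domRestrict γ, continuousOn_iff_continuous_domRestrict.1 hγ⟩ e he.symm
  -- The lift is continued by its end values outside the unit interval, so that it is continuous on
  -- all of `ℝ`.
  refine ⟨fun t => L (Set.projIcc 0 1 zero_le_one t), L.continuous.comp continuous_projIcc, ?_, ?_⟩
  · simpa using hL0
  · intro t ht
    simp only [Set.projIcc_of_mem _ ht]
    exact congrFun hL ⟨t, ht⟩

theorem Finset.exists_pos_forall_abs_sub_lt (S : Finset ℝ) (t : ℝ) :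
    ∃ ε > 0, ∀ s ∈ S, |s - t| < ε → s = t := by
  have h1 : ((S.erase t : Finset ℝ) : Set ℝ)ᶜ ∈ 𝓝 t :=
    (S.erase t).finite_toSet.isClosed.isOpen_compl.mem_nhds (by simp)
  obtain ⟨ε, hε, hb⟩ := Metric.mem_nhds_iff.1 h1
  refine ⟨ε, hε, fun s hs hst => ?_⟩
  by_contra hne
  exact hb (show s ∈ Metric.ball t ε by rwa [Metric.mem_ball, Real.dist_eq]) (by simp [hs, hne])

/-- This is the fundamental theorem of calculus with a countable exceptional set; it keeps one
coordinate of a lifted curve constant across break points. -/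
theorem eq_of_hasDerivAt_zero_off_finset {V : Type*} [NormedAddCommGroup V] [NormedSpace ℝ V]
    [CompleteSpace V] {f : ℝ → V} (hf : Continuous f) (S : Finset ℝ)
    (h : ∀ t ∈ Set.Ioo (0 : ℝ) 1, t ∉ S → HasDerivAt f 0 t) : ∀ t ∈ Set.Icc (0 : ℝ) 1, f t = f 0 := by
  intro t ht
  have := MeasureTheory.integral_eq_of_hasDerivAt_off_countable_of_le f (fun _ => (0 : V)) ht.1
    S.countable_toSet hf.continuousOn
    (fun x hx => h x ⟨hx.1.1, hx.1.2.trans_le ht.2⟩ hx.2) intervalIntegrable_const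
  rw [intervalIntegral.integral_zero] at this
  exact (sub_eq_zero.1 this.symm)

section TangentCurves

variable {m : ℕ} {M : Type*} [TopologicalSpace M] [ChartedSpace (Vec m) M]

/-- Smoothness is known only between break points, so continuity at `t`, possibly a break point, is
assembled from the two sides. -/
theorem continuousOn_of_piecewise {γ : ℝ → M} {S : Finset ℝ}
    (h : ∀ a b, 0 ≤ a → a < b → b ≤ 1 → (∀ s ∈ S, s ∉ Set.Ioo a b) →
      ContMDiffOn 𝓘(ℝ, ℝ) (𝓡 m) ∞ γ (Set.Icc a b)) : ContinuousOn γ (Set.Icc 0 1) := by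
  intro t ht
  obtain ⟨ε, hε, hS⟩ := S.exists_pos_forall_abs_sub_lt t
  have h1 : ContinuousWithinAt γ (Set.Icc 0 t) t := by
    rcases ht.1.eq_or_lt with h0 | h0
    · rw [← h0, Set.Icc_self]
      exact continuousWithinAt_singleton
    · have h2 := (h (max 0 (t - ε)) t (le_max_left _ _) (max_lt h0 (by linarith)) ht.2
        (fun s hs hst => by
          have h3 := (le_max_right 0 (t - ε)).trans_lt hst.1
          exact hst.2.ne (hS s hs (by rw [abs_lt]; constructor <;> linarith [hst.2])))).continuousOn
      refine (h2 t ⟨(max_lt h0 (by linarith)).le, le_rfl⟩).mono_of_mem_nhdsWithin ?_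
      have h4 : Set.Ici (max 0 (t - ε)) ∈ 𝓝 t := Ici_mem_nhds (max_lt h0 (by linarith))
      filter_upwards [mem_nhdsWithin_of_mem_nhds h4, self_mem_nhdsWithin] with s hs hs'
      exact ⟨hs, hs'.2⟩
  have h2 : ContinuousWithinAt γ (Set.Icc t 1) t := by
    rcases ht.2.eq_or_lt with h0 | h0
    · rw [← h0, Set.Icc_self]
      exact continuousWithinAt_singleton
    · have h2 := (h t (min 1 (t + ε)) ht.1 (lt_min h0 (by linarith)) (min_le_left _ _)
        (fun s hs hst => by
          have h3 := hst.2.trans_le (min_le_right 1 (t + ε))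
          exact hst.1.ne' (hS s hs (by rw [abs_lt]; constructor <;> linarith [hst.1])))).continuousOn
      refine (h2 t ⟨le_rfl, (lt_min h0 (by linarith)).le⟩).mono_of_mem_nhdsWithin ?_
      have h4 : Set.Iic (min 1 (t + ε)) ∈ 𝓝 t := Iic_mem_nhds (lt_min h0 (by linarith))
      filter_upwards [mem_nhdsWithin_of_mem_nhds h4, self_mem_nhdsWithin] with s hs hs'
      exact ⟨hs'.1, hs⟩
  rw [← Set.Icc_union_Icc_eq_Icc ht.1 ht.2]
  exact h1.union h2

theorem exists_Icc_of_notMem {S : Finset ℝ} {t : ℝ} (ht : t ∈ Set.Ioo (0 : ℝ) 1) (hS : t ∉ S) :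
    ∃ a b, 0 ≤ a ∧ a < b ∧ b ≤ 1 ∧ (∀ s ∈ S, s ∉ Set.Ioo a b) ∧ Set.Icc a b ∈ 𝓝 t := by
  obtain ⟨ε, hε, h⟩ := S.exists_pos_forall_abs_sub_lt t
  have h1 : max 0 (t - ε) < t := max_lt ht.1 (by linarith)
  have h2 : t < min 1 (t + ε) := lt_min ht.2 (by linarith)
  refine ⟨max 0 (t - ε), min 1 (t + ε), le_max_left _ _, h1.trans h2, min_le_left _ _, ?_,
    Icc_mem_nhds h1 h2⟩
  intro s hs hst
  have h3 := (le_max_right 0 (t - ε)).trans_lt hst.1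
  have h4 := hst.2.trans_le (min_le_right 1 (t + ε))
  exact hS (h s hs (by rw [abs_lt]; constructor <;> linarith) ▸ hs)

end TangentCurves

section Velocity

variable {m : ℕ} {M : Type*} [TopologicalSpace M] [ChartedSpace (Vec m) M]
  {E : Type*} [NormedAddCommGroup E] [NormedSpace ℝ E]

theorem mfderiv_comp_of_hasDerivAt {F : E → M} {g : ℝ → E} {g' : E} {t : ℝ}
    (hF : MDifferentiableAt 𝓘(ℝ, E) (𝓡 m) F (g t)) (hg : HasDerivAt g g' t) :
    (mfderiv 𝓘(ℝ, ℝ) (𝓡 m) (fun s => F (g s)) t (1 : ℝ) : Vec m) =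
      (mfderiv 𝓘(ℝ, E) (𝓡 m) F (g t) g' : Vec m) := by
  have e1 := mfderiv_comp_of_hasFDerivAt hF hg.hasFDerivAt 1
  have e2 : (ContinuousLinearMap.toSpanSingleton ℝ g') 1 = g' := by simp
  exact e1.trans (congrArg (fun w : E => (mfderiv 𝓘(ℝ, E) (𝓡 m) F (g t) w : Vec m)) e2)

end Velocity

theorem HasDerivAt.fst_prod {E F : Type*} [NormedAddCommGroup E] [NormedSpace ℝ E]
    [NormedAddCommGroup F] [NormedSpace ℝ F] {g : ℝ → E × F} {g' : E × F} {t : ℝ}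
    (hg : HasDerivAt g g' t) : HasDerivAt (fun s => (g s).1) g'.1 t :=
  (ContinuousLinearMap.fst ℝ E F).hasFDerivAt.comp_hasDerivAt t hg

theorem HasDerivAt.snd_prod {E F : Type*} [NormedAddCommGroup E] [NormedSpace ℝ E]
    [NormedAddCommGroup F] [NormedSpace ℝ F] {g : ℝ → E × F} {g' : E × F} {t : ℝ}
    (hg : HasDerivAt g g' t) : HasDerivAt (fun s => (g s).2) g'.2 t :=
  (ContinuousLinearMap.snd ℝ E F).hasFDerivAt.comp_hasDerivAt t hg

/-! ### The covering of `M` and the Ehresmann rectangles -/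

section Rectangles

variable {n : ℕ} {M : Type*} [TopologicalSpace M] [ChartedSpace (Vec (n + 1)) M]
  {φ : Vec n → M → M} {P : Set M} {p : ℝ → M} {G : ℝ → Vec n → Vec n}
  [T2Space M] [IsManifold (𝓡 (n + 1)) ∞ M]

namespace IsAdaptedFamily

variable (hG : IsAdaptedFamily φ P p G)
include hG

theorem isCoveringMap (hφ : IsSmoothAction φ) (hfree : IsLocallyFree φ)
    (hP : IsClosedTransversal φ P p) : IsCoveringMap (adaptedBox φ p G) := by
  refine (hG.isLocalDiffeomorph hφ hfree hP).isLocalHomeomorph.isCoveringMap_of_transitive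
    (hG.surjective_adaptedBox hφ hP) ?_
  rintro ⟨k, t⟩ ⟨k', t'⟩ h
  obtain ⟨τ, hτ, rfl, hτ'⟩ := hG.exists_transport_curve hφ hfree hP h
  have := hτ.continuous
  refine ⟨fun q => (k' + (q.1 - k), τ q.2), by fun_prop, ?_, by simp⟩
  rintro ⟨l, s⟩
  simpa using (hτ' s (l - k)).symm

theorem mem_pushField_iff (hφ : IsSmoothAction φ) (hfree : IsLocallyFree φ)
    (hP : IsClosedTransversal φ P p) (q : Vec n × ℝ) (w : Vec (n + 1)) :
    w ∈ pushField (adaptedBox φ p G) (adaptedBox φ p G q) ↔ ∃ r : ℝ,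
      (mfderiv 𝓘(ℝ, Vec n × ℝ) (𝓡 (n + 1)) (adaptedBox φ p G) q ((0, r) : Vec n × ℝ) :
        Vec (n + 1)) = w := by
  have hb : ∀ r : ℝ, r • boxDirection (adaptedBox φ p G) q =
      (mfderiv 𝓘(ℝ, Vec n × ℝ) (𝓡 (n + 1)) (adaptedBox φ p G) q ((0, r) : Vec n × ℝ) :
        Vec (n + 1)) := by
    intro r
    set A : Vec n × ℝ →L[ℝ] Vec (n + 1) :=
      mfderiv 𝓘(ℝ, Vec n × ℝ) (𝓡 (n + 1)) (adaptedBox φ p G) q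
    change r • A (0, 1) = A (0, r)
    rw [← map_smul]
    simp
  rw [hG.pushField_apply hφ hfree hP]
  refine Submodule.mem_span_singleton.trans ?_
  simp only [hb]
  exact Iff.rfl

/-- Piecewise smooth curves lift to the parametrization. -/
theorem exists_lift_curve (hφ : IsSmoothAction φ) (hfree : IsLocallyFree φ)
    (hP : IsClosedTransversal φ P p) {γ : ℝ → M} {S : Finset ℝ}
    (h : ∀ a b, 0 ≤ a → a < b → b ≤ 1 → (∀ s ∈ S, s ∉ Set.Ioo a b) →
      ContMDiffOn 𝓘(ℝ, ℝ) (𝓡 (n + 1)) ∞ γ (Set.Icc a b)) {e : Vec n × ℝ}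
    (he : adaptedBox φ p G e = γ 0) :
    ∃ Γ : ℝ → Vec n × ℝ, Continuous Γ ∧ Γ 0 = e ∧
      (∀ t ∈ Set.Icc (0 : ℝ) 1, adaptedBox φ p G (Γ t) = γ t) ∧
      (∀ a b, 0 ≤ a → a < b → b ≤ 1 → (∀ s ∈ S, s ∉ Set.Ioo a b) →
        ContDiffOn ℝ ∞ Γ (Set.Icc a b)) ∧
      ∀ t ∈ Set.Ioo (0 : ℝ) 1, t ∉ S → ∃ Γ' : Vec n × ℝ, HasDerivAt Γ Γ' t ∧
        (velocity γ t : Vec (n + 1)) = (mfderiv 𝓘(ℝ, Vec n × ℝ) (𝓡 (n + 1)) (adaptedBox φ p G)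
          (Γ t) Γ' : Vec (n + 1)) := by
  obtain ⟨Γ, hΓ, hΓ0, hΓγ⟩ := (hG.isCoveringMap hφ hfree hP).exists_lift_Icc
    (continuousOn_of_piecewise h) he
  have hsm : ∀ a b, 0 ≤ a → a < b → b ≤ 1 → (∀ s ∈ S, s ∉ Set.Ioo a b) →
      ContDiffOn ℝ ∞ Γ (Set.Icc a b) := by
    intro a b ha hab hb hS t ht
    refine (hG.isLocalDiffeomorph hφ hfree hP (Γ t)).contDiffWithinAt_of_comp
      hΓ.continuousWithinAt ?_
    exact (h a b ha hab hb hS t ht).congr (fun s hs => hΓγ s ⟨ha.trans hs.1, hs.2.trans hb⟩)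
      (hΓγ t ⟨ha.trans ht.1, ht.2.trans hb⟩)
  refine ⟨Γ, hΓ, hΓ0, hΓγ, hsm, fun t ht htS => ?_⟩
  obtain ⟨a, b, ha, hab, hb, hS, hn⟩ := exists_Icc_of_notMem ht htS
  have hd : HasDerivAt Γ (deriv Γ t) t :=
    (((hsm a b ha hab hb hS).contDiffAt hn).differentiableAt (by simp)).hasDerivAt
  refine ⟨_, hd, ?_⟩
  have e1 := mfderiv_comp_of_hasDerivAt ((hG.contMDiff_adaptedBox hφ hP).mdifferentiableAt
    (by simp)) hd
  have e2 : (fun s => adaptedBox φ p G (Γ s)) =ᶠ[𝓝 t] γ := by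
    filter_upwards [Icc_mem_nhds ht.1 ht.2] with s hs using hΓγ s hs
  have e3 : (mfderiv 𝓘(ℝ, ℝ) (𝓡 (n + 1)) (fun s => adaptedBox φ p G (Γ s)) t : ℝ →L[ℝ] Vec (n + 1))
      = mfderiv 𝓘(ℝ, ℝ) (𝓡 (n + 1)) γ t := e2.mfderiv_eq
  exact (congrArg (fun L : ℝ →L[ℝ] Vec (n + 1) => L 1) e3).symm.trans e1

/-- Both edges lift from one point `e`. Tangency to the leaves freezes the `t`-coordinate of the
lift `A` of `v`, and tangency to the field freezes the `k`-coordinate of the lift `B` of `w`. The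
rectangle combines the free coordinates of the two. -/
theorem rectangle (hφ : IsSmoothAction φ) (hfree : IsLocallyFree φ)
    (hP : IsClosedTransversal φ P p) (v w : ℝ → M) (hv : IsTangentCurve (leafTangent φ) v)
    (hw : IsTangentCurve (pushField (adaptedBox φ p G)) w) (h0 : v 0 = w 0) :
    ∃ R : ℝ × ℝ → M, IsPiecewiseSmoothSquare (n := n) R ∧
      (∀ s ∈ Set.Icc (0 : ℝ) 1, R (s, 0) = v s) ∧
      (∀ t ∈ Set.Icc (0 : ℝ) 1, R (0, t) = w t) ∧
      (∀ t ∈ Set.Icc (0 : ℝ) 1, IsTangentCurve (leafTangent φ) (fun s => R (s, t))) ∧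
      ∀ s ∈ Set.Icc (0 : ℝ) 1,
        IsTangentCurve (pushField (adaptedBox φ p G)) (fun t => R (s, t)) := by
  obtain ⟨Sv, hv1, hv2⟩ := hv
  obtain ⟨Sw, hw1, hw2⟩ := hw
  obtain ⟨e, he⟩ := hG.surjective_adaptedBox hφ hP (v 0)
  obtain ⟨A, hA, hA0, hAv, hAs, hAd⟩ := hG.exists_lift_curve hφ hfree hP hv1 he
  obtain ⟨B, hB, hB0, hBw, hBs, hBd⟩ := hG.exists_lift_curve hφ hfree hP hw1 (he.trans h0)
  have hsm := hG.contMDiff_adaptedBox hφ hP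
  have hinj : ∀ q, Function.Injective (fun u : Vec n × ℝ => (mfderiv 𝓘(ℝ, Vec n × ℝ)
      (𝓡 (n + 1)) (adaptedBox φ p G) q u : Vec (n + 1))) := fun q =>
    ((hG.isLocalDiffeomorph hφ hfree hP q).mfderivToContinuousLinearEquiv (by simp)).injective
  have hA2 : ∀ s ∈ Set.Icc (0 : ℝ) 1, (A s).2 = e.2 := by
    intro s hs
    rw [← hA0]
    refine eq_of_hasDerivAt_zero_off_finset (f := fun s => (A s).2) (by fun_prop) Sv ?_ s hs
    intro t ht htS
    obtain ⟨A', hA', hA''⟩ := hAd t ht htS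
    have h1 := hv2 t ht htS
    rw [← hAv t ⟨ht.1.le, ht.2.le⟩] at h1
    obtain ⟨u, hu⟩ := (hG.mem_leafTangent_iff hφ hP _ _ _).1 h1
    have h2 : ((u, 0) : Vec n × ℝ) = A' := hinj (A t) (hu.trans hA'')
    have h3 := hA'.snd_prod
    rw [← h2] at h3
    exact h3
  have hB1 : ∀ s ∈ Set.Icc (0 : ℝ) 1, (B s).1 = e.1 := by
    intro s hs
    rw [← hB0]
    refine eq_of_hasDerivAt_zero_off_finset (f := fun s => (B s).1) (by fun_prop) Sw ?_ s hs
    intro t ht htS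
    obtain ⟨B', hB', hB''⟩ := hBd t ht htS
    have h1 := hw2 t ht htS
    rw [← hBw t ⟨ht.1.le, ht.2.le⟩] at h1
    obtain ⟨r, hr⟩ := (hG.mem_pushField_iff hφ hfree hP _ _).1 h1
    have h2 : ((0, r) : Vec n × ℝ) = B' := hinj (B t) (hr.trans hB'')
    have h3 := hB'.fst_prod
    rw [← h2] at h3
    exact h3
  refine ⟨fun q => adaptedBox φ p G ((A q.1).1, (B q.2).2), ?_, ?_, ?_, ?_, ?_⟩
  · refine ⟨Sv ∪ Sw, fun a b c d ha hab hb hc hcd hd hS => ?_⟩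
    refine hsm.comp_contMDiffOn (contMDiffOn_iff_contDiffOn.2 ?_)
    have h1 := hAs a b ha hab hb fun s hs => (hS s (Finset.mem_union_left _ hs)).1
    have h2 := hBs c d hc hcd hd fun s hs => (hS s (Finset.mem_union_right _ hs)).2
    exact (h1.fst.comp contDiff_fst.contDiffOn fun q hq => hq.1).prodMk
      (h2.snd.comp contDiff_snd.contDiffOn fun q hq => hq.2)
  · intro s hs
    rw [← hAv s hs]
    simp only
    rw [hB0, ← hA2 s hs]
  · intro t ht
    rw [← hBw t ht]
    simp only
    rw [hA0, ← hB1 t ht]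
  · intro t ht
    refine ⟨Sv, fun a b ha hab hb hS => ?_, fun s hs hsS => ?_⟩
    · have h1 : ContDiffOn ℝ ∞ (fun s => ((A s).1, (B t).2)) (Set.Icc a b) :=
        (hAs a b ha hab hb hS).fst.prodMk contDiffOn_const
      exact hsm.comp_contMDiffOn (contMDiffOn_iff_contDiffOn.2 h1)
    · obtain ⟨A', hA', -⟩ := hAd s hs hsS
      have h1 : HasDerivAt (fun s => ((A s).1, (B t).2)) (A'.1, 0) s :=
        hA'.fst_prod.prodMk (hasDerivAt_const s (B t).2)
      exact (hG.mem_leafTangent_iff hφ hP _ _ _).2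
        ⟨A'.1, (mfderiv_comp_of_hasDerivAt (hsm.mdifferentiableAt (by simp)) h1).symm⟩
  · intro s hs
    refine ⟨Sw, fun a b ha hab hb hS => ?_, fun t ht htS => ?_⟩
    · have h1 : ContDiffOn ℝ ∞ (fun t => ((A s).1, (B t).2)) (Set.Icc a b) :=
        contDiffOn_const.prodMk (hBs a b ha hab hb hS).snd
      exact hsm.comp_contMDiffOn (contMDiffOn_iff_contDiffOn.2 h1)
    · obtain ⟨B', hB', -⟩ := hBd t ht htS
      have h1 : HasDerivAt (fun t => ((A s).1, (B t).2)) (0, B'.2) t :=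
        (hasDerivAt_const t (A s).1).prodMk hB'.snd_prod
      exact (hG.mem_pushField_iff hφ hfree hP _ _).2
        ⟨B'.2, (mfderiv_comp_of_hasDerivAt (hsm.mdifferentiableAt (by simp)) h1).symm⟩

/-- An adapted family yields the new action and its invariant Ehresmann connection. -/
theorem exists_action (hφ : IsSmoothAction φ) (hfree : IsLocallyFree φ)
    (hP : IsClosedTransversal φ P p) :
    ∃ ψ : Vec n → M → M, IsSmoothAction ψ ∧ IsLocallyFree ψ ∧ (∀ x, leaf ψ x = leaf φ x) ∧
      IsInvariantTransversal ψ P ∧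
      ∃ D : ∀ x : M, Submodule ℝ (TangentSpace (𝓡 (n + 1)) x),
        IsEhresmannConnection φ D ∧ IsInvariantField ψ D ∧
        ∀ t, D (p t) = Submodule.span ℝ {velocity p t} :=
  ⟨pushAction (adaptedBox φ p G), hG.isSmoothAction_pushAction hφ hfree hP,
    hG.isLocallyFree_pushAction hφ hfree hP, hG.leaf_pushAction hφ hP,
    hG.isInvariantTransversal hφ hP, pushField (adaptedBox φ p G),
    ⟨hG.exists_smooth_section hφ hfree hP, hG.isCompl_pushField hφ hfree hP,
      hG.rectangle hφ hfree hP⟩,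
    hG.isInvariantField hφ hfree hP, hG.pushField_transversal hφ hfree hP⟩

end IsAdaptedFamily

end Rectangles

/-! ### Extending a curve of independent families to a curve of frames -/

section Frames

variable {n : ℕ}

/-- A curve of linearly independent families of at most `n - 2` vectors avoids a fixed vector. -/
theorem exists_const_linearIndependent_snoc {k : ℕ} (hk : k + 1 < n) {c : Fin k → ℝ → Vec n}
    (hc : ∀ i, ContDiff ℝ ∞ (c i)) (hli : ∀ t, LinearIndependent ℝ fun i => c i t) :
    ∃ b : Vec n, ∀ t, LinearIndependent ℝ (Fin.snoc (fun i => c i t) b : Fin (k + 1) → Vec n) := by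
  let f : (Fin k → ℝ) × ℝ → Vec n := fun q => ∑ i, q.1 i • c i q.2
  have hf : ContDiff ℝ 1 f := by
    refine ContDiff.sum fun i _ => ?_
    have h1 : ContDiff ℝ 1 (c i) := (hc i).of_le (by exact_mod_cast (le_top : (1 : ℕ∞) ≤ ⊤))
    have h2 : ContDiff ℝ 1 fun q : (Fin k → ℝ) × ℝ => q.1 i :=
      (contDiff_apply ℝ ℝ i).comp contDiff_fst
    exact h2.smul (h1.comp contDiff_snd)
  -- The union over `t` of the spans is the image of a `C¹` map from a space of dimension `k + 1 <
  -- n`, so its complement is dense.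
  have hd := hf.dense_compl_range_of_finrank_lt_finrank (by simpa using hk)
  obtain ⟨b, hb⟩ := hd.nonempty
  refine ⟨b, fun t => linearIndependent_finSnoc.2 ⟨hli t, fun hmem => hb ?_⟩⟩
  obtain ⟨a, ha⟩ := (Submodule.mem_span_range_iff_exists_fun ℝ).1 hmem
  exact ⟨(a, t), ha⟩

/-- The generalized cross product of `k` vectors in `ℝ^(k+1)`. -/
noncomputable def crossVector {k : ℕ} (c : Fin k → Vec (k + 1)) : Vec (k + 1) :=
  WithLp.toLp 2 fun j => Matrix.det
    (Matrix.of (Fin.snoc (fun i => (c i : Fin (k + 1) → ℝ)) (Pi.single j 1)))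

/-- The determinant is linear in its last row, which is expanded in the standard basis. -/
theorem inner_crossVector {k : ℕ} (c : Fin k → Vec (k + 1)) (x : Vec (k + 1)) :
    ∑ j, x j * crossVector c j = Matrix.det
      (Matrix.of (Fin.snoc (fun i => (c i : Fin (k + 1) → ℝ)) (x : Fin (k + 1) → ℝ))) := by
  have h : ∀ y : Fin (k + 1) → ℝ, Matrix.det
      (Matrix.of (Fin.snoc (fun i => (c i : Fin (k + 1) → ℝ)) y)) =
      (Matrix.detRowAlternating (R := ℝ) (n := Fin (k + 1))).toMultilinearMap.toLinearMap
        (Fin.snoc (fun i => (c i : Fin (k + 1) → ℝ)) 0) (Fin.last k) y := by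
    intro y
    rw [MultilinearMap.toLinearMap_apply, Fin.update_snoc_last]
    rfl
  simp only [crossVector, h]
  conv_rhs => rw [show (x : Fin (k + 1) → ℝ) = ∑ j, x j • Pi.single j (1 : ℝ) by
    simpa using (pi_eq_sum_univ' (x : Fin (k + 1) → ℝ))]
  rw [map_sum]
  refine Finset.sum_congr rfl fun j _ => ?_
  rw [map_smul, smul_eq_mul]

theorem contDiff_crossVector {k : ℕ} {c : Fin k → ℝ → Vec (k + 1)}
    (hc : ∀ i, ContDiff ℝ ∞ (c i)) : ContDiff ℝ ∞ fun t => crossVector fun i => c i t := by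
  rw [contDiff_euclidean]
  intro j
  simp only [crossVector, Matrix.det_apply]
  refine ContDiff.sum fun σ _ => ContDiff.const_smul _ (contDiff_prod fun i _ => ?_)
  simp only [Matrix.of_apply]
  refine Fin.lastCases ?_ (fun l => ?_) (σ i)
  · simp only [Fin.snoc_last]
    exact contDiff_const
  · simp only [Fin.snoc_castSucc]
    exact (contDiff_euclidean.1 (hc l)) i

theorem linearIndependent_snoc_iff_det {k : ℕ} (c : Fin k → Vec (k + 1)) (x : Vec (k + 1)) :
    LinearIndependent ℝ (Fin.snoc c x : Fin (k + 1) → Vec (k + 1)) ↔ Matrix.det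
      (Matrix.of (Fin.snoc (fun i => (c i : Fin (k + 1) → ℝ)) (x : Fin (k + 1) → ℝ))) ≠ 0 := by
  have h1 : (Matrix.of (Fin.snoc (fun i => (c i : Fin (k + 1) → ℝ)) (x : Fin (k + 1) → ℝ))).row =
      (WithLp.linearEquiv 2 ℝ (Fin (k + 1) → ℝ)) ∘
        (Fin.snoc c x : Fin (k + 1) → Vec (k + 1)) := by
    funext i
    refine Fin.lastCases ?_ (fun l => ?_) i
    · funext j
      simp [Matrix.row]
    · funext j
      simp [Matrix.row]
  rw [← isUnit_iff_ne_zero, ← Matrix.isUnit_iff_isUnit_det,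
    ← Matrix.linearIndependent_rows_iff_isUnit, h1]
  exact (LinearMap.linearIndependent_iff (WithLp.linearEquiv 2 ℝ (Fin (k + 1) → ℝ)).toLinearMap
    (LinearEquiv.ker _)).symm

/-- The determinant of the extended family is the squared length of the cross vector. If it
vanished, no vector at all would complete the family, although the span is proper. -/
theorem linearIndependent_snoc_crossVector {k : ℕ} {c : Fin k → Vec (k + 1)}
    (hli : LinearIndependent ℝ c) :
    LinearIndependent ℝ (Fin.snoc c (crossVector c) : Fin (k + 1) → Vec (k + 1)) := by
  rw [linearIndependent_snoc_iff_det, ← inner_crossVector]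
  intro h
  have h0 : ∀ j, crossVector c j = 0 := fun j => by
    have := (Finset.sum_eq_zero_iff_of_nonneg fun j _ => mul_self_nonneg (crossVector c j)).1 h j
      (Finset.mem_univ j)
    exact mul_self_eq_zero.1 this
  have hlt : Module.finrank ℝ (Submodule.span ℝ (Set.range c)) < Module.finrank ℝ (Vec (k + 1)) := by
    rw [finrank_span_eq_card hli]
    simp
  obtain ⟨x, hx⟩ : ∃ x, x ∉ Submodule.span ℝ (Set.range c) := by
    by_contra! hall
    rw [Submodule.eq_top_iff'.2 hall, finrank_top] at hlt
    exact lt_irrefl _ hlt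
  refine (linearIndependent_snoc_iff_det c x).1 (linearIndependent_finSnoc.2 ⟨hli, hx⟩) ?_
  rw [← inner_crossVector]
  simp [h0]

/-- A smooth curve of linearly independent families extends to a curve of frames, which depends
on the family only. -/
theorem exists_frame (k : ℕ) (hk : k ≤ n) (c : Fin k → ℝ → Vec n)
    (hc : ∀ i, ContDiff ℝ ∞ (c i)) (hli : ∀ t, LinearIndependent ℝ fun i => c i t) :
    ∃ w : Fin n → ℝ → Vec n, (∀ i, ContDiff ℝ ∞ (w i)) ∧
      (∀ t, LinearIndependent ℝ fun i => w i t) ∧ (∀ i, w (Fin.castLE hk i) = c i) ∧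
      ∀ t t', (∀ i, c i t = c i t') → ∀ i, w i t = w i t' := by
  induction hd : n - k generalizing k with
  | zero =>
    obtain rfl : k = n := by omega
    exact ⟨c, hc, hli, fun i => rfl, fun t t' h i => h i⟩
  | succ d ih =>
    obtain ⟨x, hx, hxl, hxc⟩ : ∃ x : ℝ → Vec n, ContDiff ℝ ∞ x ∧
        (∀ t, LinearIndependent ℝ (Fin.snoc (fun i => c i t) (x t) : Fin (k + 1) → Vec n)) ∧
        ∀ t t', (∀ i, c i t = c i t') → x t = x t' := by
      -- While at least two vectors are missing, a constant one can be added. For the last one the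
      -- spans may sweep out all of `ℝⁿ`, and the cross product is used; it too depends only on the
      -- values of the family.
      rcases Nat.lt_or_ge (k + 1) n with h | h
      · obtain ⟨b, hb⟩ := exists_const_linearIndependent_snoc h hc hli
        exact ⟨fun _ => b, contDiff_const, hb, fun _ _ _ => rfl⟩
      · obtain rfl : n = k + 1 := by omega
        exact ⟨fun t => crossVector fun i => c i t, contDiff_crossVector hc,
          fun t => linearIndependent_snoc_crossVector (hli t),
          fun t t' h => congrArg crossVector (funext h)⟩
    have hsn : ∀ t, (fun i : Fin (k + 1) => (Fin.snoc c x : Fin (k + 1) → ℝ → Vec n) i t) =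
        (Fin.snoc (fun i => c i t) (x t) : Fin (k + 1) → Vec n) := by
      intro t
      funext i
      refine Fin.lastCases ?_ (fun l => ?_) i <;> simp
    obtain ⟨w, hw, hwl, hwc, hwt⟩ := ih (k + 1) (by omega) (Fin.snoc c x)
      (fun i => by refine Fin.lastCases ?_ (fun l => ?_) i <;> simp [hx, hc])
      (fun t => by rw [hsn]; exact hxl t) (by omega)
    refine ⟨w, hw, hwl, fun i => ?_, fun t t' h => hwt t t' fun i => ?_⟩
    · have := hwc i.castSucc
      rw [Fin.snoc_castSucc] at this
      rw [← this]
      rfl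
    · refine Fin.lastCases ?_ (fun l => ?_) i
      · simpa using hxc t t' h
      · simpa using h l

end Frames

/-! ### Smooth increasing interpolation, equivariant under index shifts -/

section Interpolation

theorem exists_smoothStep : ∃ Y : ℝ → ℝ, ContDiff ℝ ∞ Y ∧ (∀ s ≤ 0, Y s = 0) ∧ (∀ s, 1 ≤ s → Y s = 1) ∧
    (∀ s, 0 ≤ deriv Y s) ∧ ∀ s ∈ Set.Ioo (0 : ℝ) 1, 0 < deriv Y s := by
  -- The bump is positive exactly on the open unit interval; the step is its integral divided by the
  -- total mass `C`.
  let f : ContDiffBump (1 / 2 : ℝ) := ⟨1 / 4, 1 / 2, by norm_num, by norm_num⟩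
  have hf : Continuous f := f.continuous
  have hzero : ∀ s, s ∉ Set.Ioo (0 : ℝ) 1 → f s = 0 := by
    intro s hs
    refine f.zero_of_le_dist ?_
    change 1 / 2 ≤ dist s (1 / 2)
    rw [Real.dist_eq]
    by_contra! h
    rw [abs_lt] at h
    exact hs ⟨by linarith, by linarith⟩
  have hpos : ∀ s ∈ Set.Ioo (0 : ℝ) 1, 0 < f s := by
    intro s hs
    refine f.pos_of_mem_ball ?_
    change dist s (1 / 2) < 1 / 2
    rw [Real.dist_eq, abs_lt]
    constructor <;> linarith [hs.1, hs.2]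
  set C := ∫ u in (0 : ℝ)..1, f u with hC
  have hCpos : 0 < C := intervalIntegral.intervalIntegral_pos_of_pos_on
    (hf.intervalIntegrable _ _) hpos one_pos
  have hd : ∀ s, HasDerivAt (fun s => (∫ u in (0 : ℝ)..s, f u) / C) (f s / C) s := fun s =>
    (intervalIntegral.integral_hasDerivAt_right (hf.intervalIntegrable _ _)
      (hf.stronglyMeasurableAtFilter _ _) hf.continuousAt).div_const C
  have hder : deriv (fun s => (∫ u in (0 : ℝ)..s, f u) / C) = fun s => f s / C :=
    funext fun s => (hd s).deriv
  refine ⟨fun s => (∫ u in (0 : ℝ)..s, f u) / C, ?_, ?_, ?_, ?_, ?_⟩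
  · rw [contDiff_infty_iff_deriv, hder]
    exact ⟨fun s => (hd s).differentiableAt, f.contDiff.div_const C⟩
  · intro s hs
    simp only
    rw [intervalIntegral.integral_congr (g := fun _ => (0 : ℝ)), intervalIntegral.integral_zero,
      zero_div]
    intro u hu
    rw [Set.uIcc_of_ge hs] at hu
    exact hzero u fun h => absurd h.1 (not_lt.2 hu.2)
  · intro s hs
    have h1 : ∫ u in (1 : ℝ)..s, f u = 0 := by
      rw [intervalIntegral.integral_congr (g := fun _ => (0 : ℝ)), intervalIntegral.integral_zero]
      intro u hu
      rw [Set.uIcc_of_le hs] at hu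
      exact hzero u fun h => absurd h.2 (not_lt.2 hu.1)
    simp only
    rw [← intervalIntegral.integral_add_adjacent_intervals (hf.intervalIntegrable 0 1)
      (hf.intervalIntegrable 1 s), h1, add_zero, div_self hCpos.ne']
  · intro s
    rw [hder]
    exact div_nonneg f.nonneg hCpos.le
  · intro s hs
    rw [hder]
    exact div_pos (hpos s hs) hCpos

/-- A smooth step from `0` to `1` on the unit interval. -/
noncomputable def smoothStep : ℝ → ℝ := exists_smoothStep.choose

theorem contDiff_smoothStep : ContDiff ℝ ∞ smoothStep := exists_smoothStep.choose_spec.1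

theorem smoothStep_of_nonpos {s : ℝ} (hs : s ≤ 0) : smoothStep s = 0 :=
  exists_smoothStep.choose_spec.2.1 s hs

theorem smoothStep_of_one_le {s : ℝ} (hs : 1 ≤ s) : smoothStep s = 1 :=
  exists_smoothStep.choose_spec.2.2.1 s hs

theorem deriv_smoothStep_nonneg (s : ℝ) : 0 ≤ deriv smoothStep s :=
  exists_smoothStep.choose_spec.2.2.2.1 s

theorem deriv_smoothStep_pos {s : ℝ} (hs : s ∈ Set.Ioo (0 : ℝ) 1) : 0 < deriv smoothStep s :=
  exists_smoothStep.choose_spec.2.2.2.2 s hs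

theorem smoothStep_mem_Icc (s : ℝ) : smoothStep s ∈ Set.Icc (0 : ℝ) 1 := by
  have hm : Monotone smoothStep := monotone_of_deriv_nonneg
    (contDiff_smoothStep.differentiable (by simp)) deriv_smoothStep_nonneg
  refine ⟨?_, ?_⟩
  · rw [← smoothStep_of_nonpos (min_le_right s 0)]
    exact hm (min_le_left _ _)
  · rw [← smoothStep_of_one_le (le_max_right s 1)]
    exact hm (le_max_left _ _)

/-- The slope at the node `m` of the interpolation with increments `ℓ`. -/
noncomputable def nodeSlope (ℓ : ℤ → ℝ) (m : ℤ) : ℝ := ℓ (m - 1) * ℓ m / (ℓ (m - 1) + ℓ m)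

/-- The increment between the nodes `m` and `m + 1` that the slopes at the nodes leave over. -/
noncomputable def restIncrement (ℓ : ℤ → ℝ) (m : ℤ) : ℝ :=
  ℓ m - (1 - smoothStep (1 / 2)) * nodeSlope ℓ m - smoothStep (1 / 2) * nodeSlope ℓ (m + 1)

/-- The contribution of the node `m` to the interpolation with increments `ℓ`. -/
noncomputable def interpTerm (ℓ : ℤ → ℝ) (m : ℤ) (s : ℝ) : ℝ :=
  nodeSlope ℓ m * (smoothStep (s - m + 1 / 2) - smoothStep (1 / 2 - m)) +
    restIncrement ℓ m * (smoothStep (s - m) - smoothStep (-m))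

/-- A smooth function vanishing at `0` with increment `ℓ m` between `m` and `m + 1`. -/
noncomputable def interp (ℓ : ℤ → ℝ) (s : ℝ) : ℝ := ∑ᶠ m, interpTerm ℓ m s

theorem interpTerm_eq_zero (ℓ : ℤ → ℝ) {m : ℤ} {s : ℝ} {N : ℕ} (hs : |s| ≤ N)
    (hm : m ∉ Finset.Icc (-((N : ℤ) + 1)) (N + 1)) : interpTerm ℓ m s = 0 := by
  rw [abs_le] at hs
  rw [Finset.mem_Icc, not_and_or, not_le, not_le] at hm
  have hN : (0 : ℝ) ≤ N := N.cast_nonneg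
  rcases hm with h | h
  · have h1 : (m : ℝ) + 1 ≤ -((N : ℝ) + 1) := by exact_mod_cast h
    rw [interpTerm, smoothStep_of_one_le, smoothStep_of_one_le, smoothStep_of_one_le,
      smoothStep_of_one_le] <;> linarith
  · have h1 : (N : ℝ) + 1 + 1 ≤ m := by exact_mod_cast h
    rw [interpTerm, smoothStep_of_nonpos, smoothStep_of_nonpos, smoothStep_of_nonpos,
      smoothStep_of_nonpos] <;> linarith

theorem interp_eq_sum (ℓ : ℤ → ℝ) {s : ℝ} {N : ℕ} (hs : |s| ≤ N) :
    interp ℓ s = ∑ m ∈ Finset.Icc (-((N : ℤ) + 1)) (N + 1), interpTerm ℓ m s := by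
  refine finsum_eq_sum_of_support_subset _ fun m hm => ?_
  by_contra h
  exact hm (interpTerm_eq_zero ℓ hs h)

theorem hasFiniteSupport_interpTerm (ℓ : ℤ → ℝ) (s : ℝ) :
    (Function.support fun m => interpTerm ℓ m s).Finite := by
  obtain ⟨N, hN⟩ := exists_nat_ge |s|
  refine (Finset.Icc (-((N : ℤ) + 1)) (N + 1)).finite_toSet.subset fun m hm => ?_
  by_contra h
  exact hm (interpTerm_eq_zero ℓ hN h)

theorem interp_zero (ℓ : ℤ → ℝ) : interp ℓ 0 = 0 := by
  rw [interp]
  refine finsum_eq_zero_of_forall_eq_zero fun m => ?_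
  rw [interpTerm, show (0 : ℝ) - m + 1 / 2 = 1 / 2 - m by ring, zero_sub]
  ring

/-- The contribution of a node depends only on the increments near it, so shifting the argument by
`j` amounts to shifting the increments. The constant `interp ℓ j` restores the value `0` at `0`.
This gives the equivariance of the adapted family in the collinear case. -/
theorem interp_add_intCast (ℓ : ℤ → ℝ) (s : ℝ) (j : ℤ) :
    interp ℓ (s + j) = interp ℓ j + interp (fun m => ℓ (m + j)) s := by
  have h1 : ∀ m, interpTerm ℓ m (s + j) - interpTerm ℓ m j =
      interpTerm (fun m => ℓ (m + j)) (m - j) s := by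
    intro m
    simp only [interpTerm, restIncrement, nodeSlope]
    rw [show m - j - 1 + j = m - 1 by ring, show m - j + 1 - 1 + j = m + 1 - 1 by ring,
      show m - j + 1 + j = m + 1 by ring, sub_add_cancel]
    push_cast
    rw [show s - ((m : ℝ) - j) + 1 / 2 = s + j - m + 1 / 2 by ring,
      show 1 / 2 - ((m : ℝ) - j) = j - m + 1 / 2 by ring,
      show s - ((m : ℝ) - j) = s + j - m by ring, show -((m : ℝ) - j) = j - m by ring]
    ring
  have h2 := finsum_sub_distrib (hasFiniteSupport_interpTerm ℓ (s + j))
    (hasFiniteSupport_interpTerm ℓ j)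
  simp only [h1] at h2
  have h3 := finsum_comp_equiv (Equiv.subRight j)
    (f := fun m => interpTerm (fun m => ℓ (m + j)) m s)
  simp only [Equiv.subRight_apply] at h3
  rw [h3] at h2
  simp only [interp]
  linarith

theorem interp_one (ℓ : ℤ → ℝ) : interp ℓ 1 = ℓ 0 := by
  rw [interp_eq_sum ℓ (N := 1) (by norm_num)]
  -- For arguments of absolute value at most `1`, only these five nodes can contribute.
  have h : Finset.Icc (-(((1 : ℕ) : ℤ) + 1)) (((1 : ℕ) : ℤ) + 1) = {-2, -1, 0, 1, 2} := by decide
  rw [h]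
  rw [Finset.sum_insert (by decide), Finset.sum_insert (by decide), Finset.sum_insert (by decide),
    Finset.sum_insert (by decide), Finset.sum_singleton]
  simp only [interpTerm]
  push_cast
  norm_num
  simp only [smoothStep_of_one_le (show (1 : ℝ) ≤ 7 / 2 by norm_num),
    smoothStep_of_one_le (show (1 : ℝ) ≤ 5 / 2 by norm_num),
    smoothStep_of_one_le (show (1 : ℝ) ≤ 3 / 2 by norm_num),
    smoothStep_of_one_le (show (1 : ℝ) ≤ 3 by norm_num),
    smoothStep_of_one_le (show (1 : ℝ) ≤ 2 by norm_num),
    smoothStep_of_one_le (show (1 : ℝ) ≤ 1 by norm_num),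
    smoothStep_of_nonpos (show (0 : ℝ) ≤ 0 by norm_num),
    smoothStep_of_nonpos (show -(1 / 2 : ℝ) ≤ 0 by norm_num),
    smoothStep_of_nonpos (show -(3 / 2 : ℝ) ≤ 0 by norm_num),
    smoothStep_of_nonpos (show -(1 : ℝ) ≤ 0 by norm_num),
    smoothStep_of_nonpos (show -(2 : ℝ) ≤ 0 by norm_num), restIncrement]
  norm_num
  ring

/-- The interpolation takes given values at the integers. -/
theorem interp_intCast {x : ℤ → ℝ} (hx : x 0 = 0) (j : ℤ) :
    interp (fun m => x (m + 1) - x m) j = x j := by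
  have hstep : ∀ i : ℤ, interp (fun m => x (m + 1) - x m) ((i + 1 : ℤ) : ℝ) =
      interp (fun m => x (m + 1) - x m) i + (x (i + 1) - x i) := by
    intro i
    have := interp_add_intCast (fun m => x (m + 1) - x m) 1 i
    rw [interp_one] at this
    push_cast
    rw [add_comm (i : ℝ) 1, this, zero_add]
  induction j using Int.induction_on with
  | zero => rw [Int.cast_zero, interp_zero, hx]
  | succ i ih => rw [hstep, ih]; ring
  | pred i ih =>
    have := hstep (-(i : ℤ) - 1)
    rw [sub_add_cancel, ih] at this
    linarith

theorem nodeSlope_pos {ℓ : ℤ → ℝ} (hℓ : ∀ m, 0 < ℓ m) (m : ℤ) : 0 < nodeSlope ℓ m :=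
  div_pos (mul_pos (hℓ _) (hℓ _)) (add_pos (hℓ _) (hℓ _))

/-- The number `ℓ (m - 1) * ℓ m / (ℓ (m - 1) + ℓ m)` is smaller than both increments adjacent to the
node `m`. So the convex combination of the values at `m` and `m + 1` with weights `1 - smoothStep (1
/ 2)` and `smoothStep (1 / 2)` stays below `ℓ m`. -/
theorem restIncrement_pos {ℓ : ℤ → ℝ} (hℓ : ∀ m, 0 < ℓ m) (m : ℤ) : 0 < restIncrement ℓ m := by
  have h1 : nodeSlope ℓ m < ℓ m := by
    rw [nodeSlope, div_lt_iff₀ (add_pos (hℓ _) (hℓ _))]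
    nlinarith [hℓ m, hℓ (m - 1), mul_pos (hℓ m) (hℓ m)]
  have h2 : nodeSlope ℓ (m + 1) < ℓ m := by
    rw [nodeSlope, add_sub_cancel_right, div_lt_iff₀ (add_pos (hℓ _) (hℓ _))]
    nlinarith [hℓ m, hℓ (m + 1), mul_pos (hℓ m) (hℓ m)]
  obtain ⟨h3, h4⟩ := smoothStep_mem_Icc (1 / 2)
  rw [restIncrement]
  rcases h3.eq_or_lt with h | h
  · rw [← h]
    linarith
  · nlinarith [mul_nonneg (sub_nonneg.2 h4) (sub_nonneg.2 h1.le), mul_pos h (sub_pos.2 h2)]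

theorem hasDerivAt_interpTerm (ℓ : ℤ → ℝ) (m : ℤ) (s : ℝ) :
    HasDerivAt (interpTerm ℓ m) (nodeSlope ℓ m * deriv smoothStep (s - m + 1 / 2) +
      restIncrement ℓ m * deriv smoothStep (s - m)) s := by
  have hd := contDiff_smoothStep.differentiable (by simp)
  have h1 : HasDerivAt (fun s : ℝ => smoothStep (s - m + 1 / 2))
      (deriv smoothStep (s - m + 1 / 2)) s :=
    ((hd _).hasDerivAt.comp_add_const (s - m) (1 / 2 : ℝ)).comp_sub_const s (m : ℝ)
  have h2 : HasDerivAt (fun s : ℝ => smoothStep (s - m)) (deriv smoothStep (s - m)) s :=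
    (hd _).hasDerivAt.comp_sub_const s (m : ℝ)
  exact ((h1.sub_const _).const_mul _).add ((h2.sub_const _).const_mul _)

/-- The interpolation has positive slope. -/
theorem exists_hasDerivAt_interp {ℓ : ℤ → ℝ} (hℓ : ∀ m, 0 < ℓ m) (s : ℝ) :
    ∃ d > 0, HasDerivAt (interp ℓ) d s := by
  obtain ⟨N, hN⟩ := exists_nat_gt |s|
  have h1 : interp ℓ =ᶠ[𝓝 s] fun s => ∑ m ∈ Finset.Icc (-((N : ℤ) + 1)) (N + 1),
      interpTerm ℓ m s := by
    filter_upwards [continuous_abs.continuousAt.eventually_lt_const hN] with r hr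
      using interp_eq_sum ℓ hr.le
  refine ⟨_, ?_, (HasDerivAt.fun_sum fun m _ => hasDerivAt_interpTerm ℓ m s).congr_of_eventuallyEq h1⟩
  have hnn : ∀ m : ℤ, 0 ≤ nodeSlope ℓ m * deriv smoothStep (s - m + 1 / 2) +
      restIncrement ℓ m * deriv smoothStep (s - m) := fun m =>
    add_nonneg (mul_nonneg (nodeSlope_pos hℓ m).le (deriv_smoothStep_nonneg _))
      (mul_nonneg (restIncrement_pos hℓ m).le (deriv_smoothStep_nonneg _))
  refine Finset.sum_pos' (fun m _ => hnn m) ⟨⌊s⌋, ?_, ?_⟩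
  · obtain ⟨h2, h3⟩ := abs_lt.1 hN
    rw [Finset.mem_Icc]
    constructor
    · rw [Int.le_floor]
      push_cast
      linarith
    · have : ⌊s⌋ < (N : ℤ) := by
        rw [Int.floor_lt]
        exact_mod_cast h3
      linarith
  · have h4 := Int.floor_le s
    have h5 := Int.lt_floor_add_one s
    -- Steps between consecutive integers alone would have slope `0` at the integers. There the step
    -- centred at the node is increasing; elsewhere the step on the interval from `⌊s⌋` to `⌊s⌋ + 1`
    -- is.
    rcases h4.eq_or_lt with h | h
    · refine add_pos_of_pos_of_nonneg (mul_pos (nodeSlope_pos hℓ _) (deriv_smoothStep_pos ?_))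
        (mul_nonneg (restIncrement_pos hℓ _).le (deriv_smoothStep_nonneg _))
      rw [h, sub_self]
      norm_num
    · refine add_pos_of_nonneg_of_pos (mul_nonneg (nodeSlope_pos hℓ _).le
        (deriv_smoothStep_nonneg _)) (mul_pos (restIncrement_pos hℓ _) (deriv_smoothStep_pos ?_))
      constructor <;> linarith

theorem contDiff_interp {ℓ : ℤ → ℝ → ℝ} (hℓ : ∀ m, ContDiff ℝ ∞ (ℓ m))
    (hpos : ∀ m t, 0 < ℓ m t) :
    ContDiff ℝ ∞ fun q : ℝ × ℝ => interp (fun m => ℓ m q.2) q.1 := by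
  have hσ : ∀ m, ContDiff ℝ ∞ fun q : ℝ × ℝ => nodeSlope (fun m => ℓ m q.2) m := by
    intro m
    have h1 := (hℓ m).comp (contDiff_snd (E := ℝ) (F := ℝ))
    have h2 := (hℓ (m - 1)).comp (contDiff_snd (E := ℝ) (F := ℝ))
    exact (h2.mul h1).div (h2.add h1) fun q => (add_pos (hpos _ _) (hpos _ _)).ne'
  have hq : ∀ m, ContDiff ℝ ∞ fun q : ℝ × ℝ => restIncrement (fun m => ℓ m q.2) m := by
    intro m
    have h1 := (hℓ m).comp (contDiff_snd (E := ℝ) (F := ℝ))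
    exact (h1.sub (contDiff_const.mul (hσ m))).sub (contDiff_const.mul (hσ (m + 1)))
  have hY := contDiff_smoothStep
  have ht : ∀ m, ContDiff ℝ ∞ fun q : ℝ × ℝ => interpTerm (fun m => ℓ m q.2) m q.1 := by
    intro m
    refine ((hσ m).mul ?_).add ((hq m).mul ?_) <;> fun_prop
  rw [contDiff_iff_contDiffAt]
  intro q
  obtain ⟨N, hN⟩ := exists_nat_gt |q.1|
  have h1 : (fun q : ℝ × ℝ => interp (fun m => ℓ m q.2) q.1) =ᶠ[𝓝 q] fun q =>
      ∑ m ∈ Finset.Icc (-((N : ℤ) + 1)) (N + 1), interpTerm (fun m => ℓ m q.2) m q.1 := by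
    filter_upwards [(continuous_abs.comp continuous_fst).continuousAt.eventually_lt_const hN]
      with r hr using interp_eq_sum _ hr.le
  exact (ContDiff.sum fun m _ => ht m).contDiffAt.congr_of_eventuallyEq h1

theorem bijective_interp {x : ℤ → ℝ} (hx : ∀ m, x m < x (m + 1)) (hx0 : x 0 = 0)
    (htop : ∀ r, ∃ m, r ≤ x m) (hbot : ∀ r, ∃ m, x m ≤ r) :
    Function.Bijective (interp fun m => x (m + 1) - x m) := by
  choose d hd hd' using exists_hasDerivAt_interp (ℓ := fun m => x (m + 1) - x m)
    fun m => sub_pos.2 (hx m)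
  have hm : StrictMono (interp fun m => x (m + 1) - x m) :=
    strictMono_of_deriv_pos fun s => by rw [(hd' s).deriv]; exact hd s
  have hc : Continuous (interp fun m => x (m + 1) - x m) :=
    continuous_iff_continuousAt.2 fun s => (hd' s).continuousAt
  refine ⟨hm.injective, hc.surjective ?_ ?_⟩
  · refine Filter.tendsto_atTop_atTop_of_monotone hm.monotone fun r => ?_
    obtain ⟨m, h⟩ := htop r
    exact ⟨m, by rwa [interp_intCast hx0]⟩
  · refine Filter.tendsto_atBot_atBot_of_monotone hm.monotone fun r => ?_
    obtain ⟨m, h⟩ := hbot r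
    exact ⟨m, by rwa [interp_intCast hx0]⟩

end Interpolation

/-! ### Direction-preserving maps are homotheties -/

section DirectionPreservingMaps

variable {V : Type*} [NormedAddCommGroup V] [NormedSpace ℝ V]

/-- A locally finite set invariant under a contracting homothety has at most one point. -/
theorem subsingleton_of_contraction {X : Set V} (hX : ∀ r, (X ∩ Metric.closedBall 0 r).Finite)
    {c : ℝ} (hc0 : 0 < c) (hc1 : c < 1) (v : V) (hf : ∀ x ∈ X, c • x + v ∈ X) :
    X.Subsingleton := by
  have h1c : (1 - c) ≠ 0 := by linarith
  -- Here `q` is the fixed point of the homothety. Iterating from any other point of `X` produces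
  -- infinitely many points in a bounded region.
  obtain ⟨q, hv⟩ : ∃ q, v = q - c • q :=
    ⟨(1 - c)⁻¹ • v, by
      have := smul_inv_smul₀ h1c v
      rwa [sub_smul, one_smul, eq_comm] at this⟩
  have key : ∀ x ∈ X, x = q := by
    intro x hx
    by_contra hne
    have hpos : 0 < ‖x - q‖ := norm_pos_iff.2 (sub_ne_zero.2 hne)
    have hmem : ∀ k : ℕ, q + c ^ k • (x - q) ∈ X := by
      intro k
      induction k with
      | zero => simpa using hx
      | succ k ih =>
        have := hf _ ih
        rw [hv] at this
        convert this using 1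
        rw [pow_succ', mul_smul, smul_add]
        abel
    have hinj : Function.Injective fun k : ℕ => q + c ^ k • (x - q) := by
      intro k l hkl
      have h2 := smul_left_injective ℝ (sub_ne_zero.2 hne) (add_left_cancel hkl)
      exact (pow_right_strictAnti₀ hc0 hc1).injective h2
    refine Set.infinite_range_of_injective hinj ((hX (‖q‖ + ‖x - q‖)).subset ?_)
    rintro _ ⟨k, rfl⟩
    refine ⟨hmem k, mem_closedBall_zero_iff.2 ((norm_add_le _ _).trans ?_)⟩
    rw [norm_smul, norm_pow, Real.norm_of_nonneg hc0.le]
    have := mul_le_mul_of_nonneg_right (pow_le_one₀ (n := k) hc0.le hc1.le) hpos.le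
    linarith
  intro x hx y hy
  rw [key x hx, key y hy]

/-- A map between non-collinear configurations which preserves directions is a homothety. -/
theorem exists_homothety {ι : Type*} {x y : ι → V} (hray : ∀ i j, SameRay ℝ (x i - x j) (y i - y j))
    (hinj : ∀ i j, x i = x j ↔ y i = y j) {o a b : ι} (hxo : x o = 0) (hyo : y o = 0)
    (hab : LinearIndependent ℝ ![x a, x b]) : ∃ c : ℝ, 0 < c ∧ ∀ i, y i = c • x i := by
  have h1 : ∀ i, ∃ c : ℝ, 0 < c ∧ y i = c • x i := by
    intro i
    by_cases hi : x i = 0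
    · refine ⟨1, one_pos, ?_⟩
      rw [hi, smul_zero, ← hyo]
      exact (hinj i o).1 (hi.trans hxo.symm)
    · have h2 := hray i o
      rw [hxo, hyo, sub_zero, sub_zero] at h2
      have hyi : y i ≠ 0 := fun h => hi (((hinj i o).2 (h.trans hyo.symm)).trans hxo)
      obtain ⟨r, hr, h3⟩ := h2.exists_pos_left hi hyi
      exact ⟨r, hr, h3.symm⟩
  choose c hc hyc using h1
  -- For independent `x i` and `x j`, the difference `c i • x i - c j • x j` is a multiple of `x i -
  -- x j` only if the factors agree. Every nonzero `x i` is independent of `x a` or of `x b`, which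
  -- links all factors.
  have h2 : ∀ i j, LinearIndependent ℝ ![x i, x j] → c i = c j := by
    intro i j hij
    have hne : x i - x j ≠ 0 := fun h => by
      have := LinearIndependent.pair_iff.1 hij 1 (-1) (by simpa [sub_eq_add_neg] using h)
      exact one_ne_zero this.1
    have hne' : y i - y j ≠ 0 := fun h => hne (sub_eq_zero.2 ((hinj i j).2 (sub_eq_zero.1 h)))
    obtain ⟨r, -, h3⟩ := (hray i j).exists_pos_left hne hne'
    rw [hyc i, hyc j] at h3
    have h4 := LinearIndependent.pair_iff.1 hij (r - c i) (c j - r) (by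
      rw [← sub_eq_zero.2 h3]
      module)
    linarith [h4.1, h4.2]
  have ha0 : x a ≠ 0 := hab.ne_zero 0
  refine ⟨c a, hc a, fun i => ?_⟩
  by_cases hi : x i = 0
  · rw [hyc i, hi, smul_zero, smul_zero]
  rw [hyc i]
  congr 1
  by_cases hia : LinearIndependent ℝ ![x i, x a]
  · exact h2 i a hia
  by_cases hib : LinearIndependent ℝ ![x i, x b]
  · rw [h2 i b hib, h2 a b hab]
  rw [LinearIndependent.pair_iff' hi] at hia hib
  push Not at hia hib
  obtain ⟨r, hr⟩ := hia
  obtain ⟨s, hs⟩ := hib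
  exfalso
  rw [← hr, ← hs] at hab
  have h5 := LinearIndependent.pair_iff.1 hab s (-r) (by
    rw [smul_smul, smul_smul, ← add_smul]
    rw [show s * r + -r * s = 0 by ring, zero_smul])
  rw [← hr, neg_eq_zero.1 h5.2, zero_smul] at ha0
  exact ha0 rfl

end DirectionPreservingMaps

/-! ### Orders isomorphic to `ℤ` -/

section OrderAutomorphisms

/-- An order automorphism of `ℤ` is a shift. -/
theorem OrderIso.int_apply_eq (f : ℤ ≃o ℤ) (m : ℤ) : f m = m + f 0 := by
  have h : ∀ k, f (k + 1) = f k + 1 := fun k => by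
    simpa only [Order.succ_eq_add_one] using f.map_succ k
  induction m with
  | zero => simp
  | succ m ih => rw [h, ih]; ring
  | pred m ih =>
    have := h (-(m : ℤ) - 1)
    rw [sub_add_cancel, ih] at this
    linarith

/-- A discrete closed set of real numbers without greatest and least element is ordered like
`ℤ`. -/
theorem exists_orderIso_int {S : Set ℝ} (hfin : ∀ a b, (S ∩ Set.Icc a b).Finite) (hne : S.Nonempty)
    (htop : ∀ x ∈ S, ∃ y ∈ S, x < y) (hbot : ∀ x ∈ S, ∃ y ∈ S, y < x) : Nonempty (ℤ ≃o S) := by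
  have : Nonempty S := hne.to_subtype
  have : NoMaxOrder S := ⟨fun x => let ⟨y, hy, h⟩ := htop x x.2; ⟨⟨y, hy⟩, h⟩⟩
  have : NoMinOrder S := ⟨fun x => let ⟨y, hy, h⟩ := hbot x x.2; ⟨⟨y, hy⟩, h⟩⟩
  have hI : ∀ a b : S, (Set.Icc a b).Finite := fun a b =>
    ((hfin a b).preimage Subtype.val_injective.injOn).subset fun x hx => ⟨x.2, hx⟩
  let _ : LocallyFiniteOrder S := LocallyFiniteOrder.ofFiniteIcc hI
  let _ : SuccOrder S := LinearLocallyFiniteOrder.succOrder S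
  let _ : PredOrder S := LinearLocallyFiniteOrder.predOrder S
  exact ⟨orderIsoIntOfLinearSuccPredArch.symm⟩

end OrderAutomorphisms

/-! ### Diffeomorphisms of `ℝⁿ` given by a frame and coordinate changes -/

section FrameFamilies

variable {n : ℕ}

/-- The map of `ℝⁿ` which reparametrizes the `i`-th coordinate by `β i t` and takes the standard
basis to the frame `w i t`. -/
noncomputable def frameMap (β : Fin n → ℝ → ℝ → ℝ) (w : Fin n → ℝ → Vec n) (t : ℝ) (k : Vec n) :
    Vec n :=
  ∑ i, β i t (k i) • w i t

variable {β : Fin n → ℝ → ℝ → ℝ} {w : Fin n → ℝ → Vec n}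

theorem contDiff_frameMap (hβ : ∀ i, ContDiff ℝ ∞ fun q : ℝ × ℝ => β i q.2 q.1)
    (hw : ∀ i, ContDiff ℝ ∞ (w i)) :
    ContDiff ℝ ∞ fun q : Vec n × ℝ => frameMap β w q.2 q.1 := by
  refine ContDiff.sum fun i _ => ?_
  have h : ContDiff ℝ ∞ fun q : Vec n × ℝ => (q.1 i, q.2) :=
    ((EuclideanSpace.proj i : Vec n →L[ℝ] ℝ).contDiff.comp contDiff_fst).prodMk contDiff_snd
  exact ((hβ i).comp h).smul ((hw i).comp contDiff_snd)

theorem frameMap_eq_iff {t : ℝ} (hli : LinearIndependent ℝ fun i => w i t) {k : Vec n}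
    {x : Fin n → ℝ} : frameMap β w t k = ∑ i, x i • w i t ↔ ∀ i, β i t (k i) = x i := by
  refine ⟨fun h i => ?_, fun h => Finset.sum_congr rfl fun i _ => by rw [h]⟩
  rw [frameMap, ← sub_eq_zero, ← Finset.sum_sub_distrib] at h
  simp only [← sub_smul] at h
  exact sub_eq_zero.1 (Fintype.linearIndependent_iff.1 hli _ h i)

theorem injective_frameMap {t : ℝ} (hβ : ∀ i, Function.Injective (β i t))
    (hli : LinearIndependent ℝ fun i => w i t) : Function.Injective (frameMap β w t) :=
  fun _ l h => PiLp.ext fun i => hβ i ((frameMap_eq_iff hli (x := fun i => β i t (l i))).1 h i)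

theorem surjective_frameMap {t : ℝ} (hβ : ∀ i, Function.Surjective (β i t))
    (hli : LinearIndependent ℝ fun i => w i t) : Function.Surjective (frameMap β w t) := by
  intro v
  have hspan : v ∈ Submodule.span ℝ (Set.range fun i => w i t) := by
    rw [hli.span_eq_top_of_card_eq_finrank' (by simp)]
    trivial
  obtain ⟨x, rfl⟩ := (Submodule.mem_span_range_iff_exists_fun ℝ).1 hspan
  choose k hk using fun i => hβ i (x i)
  exact ⟨WithLp.toLp 2 k, (frameMap_eq_iff hli).2 hk⟩

theorem injective_fderiv_frameMap {t : ℝ} {k : Vec n}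
    (hβ : ∀ i, ∃ d : ℝ, d ≠ 0 ∧ HasDerivAt (β i t) d (k i))
    (hli : LinearIndependent ℝ fun i => w i t) :
    Function.Injective (fderiv ℝ (frameMap β w t) k) := by
  choose d hd0 hd using hβ
  have h : HasFDerivAt (frameMap β w t) (∑ i, (d i • (EuclideanSpace.proj i : Vec n →L[ℝ] ℝ)).smulRight
      (w i t)) k := by
    refine HasFDerivAt.fun_sum fun i _ => HasFDerivAt.smul_const ?_ (w i t)
    exact (hd i).comp_hasFDerivAt k (EuclideanSpace.proj i : Vec n →L[ℝ] ℝ).hasFDerivAt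
  rw [h.fderiv, injective_iff_map_eq_zero]
  intro v hv
  simp only [sum_apply, ContinuousLinearMap.smulRight_apply] at hv
  ext i
  exact (mul_eq_zero.1 (Fintype.linearIndependent_iff.1 hli _ hv i)).resolve_left (hd0 i)

end FrameFamilies

/-! ### Rigidity of translations -/

section Translations

variable {n : ℕ} {M : Type*} [TopologicalSpace M] [ChartedSpace (Vec (n + 1)) M]
  {φ : Vec n → M → M} {P : Set M} {p : ℝ → M} {c d : ℝ → Vec n}

theorem IsClosedTransversal.isTranslation_zero (hP : IsClosedTransversal φ P p)
    (hφ : IsSmoothAction φ) : IsTranslation φ P p 0 :=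
  ⟨differentiable_const 0, hP.zero_mem_returnSet hφ⟩

theorem IsSmoothAction.leaf_symm (hφ : IsSmoothAction φ) {x y : M} (h : y ∈ leaf φ x) :
    x ∈ leaf φ y := by
  obtain ⟨k, rfl⟩ := h
  exact ⟨-k, hφ.neg_act k x⟩

variable [T2Space M] [IsManifold (𝓡 (n + 1)) ∞ M]

theorem IsTranslation.ext (hφ : IsSmoothAction φ) (hfree : IsLocallyFree φ)
    (hP : IsClosedTransversal φ P p) (hc : IsTranslation φ P p c) (hd : IsTranslation φ P p d)
    {t : ℝ} (h : c t = d t) : c = d :=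
  hP.return_unique hφ hfree hc.differentiable.continuous hd.differentiable.continuous hc.mem hd.mem
    h

/-- This is composition of translations: `c` moves the parameter by `τ`, and following `c` by `d`
adds `d` evaluated at the moved parameter. -/
theorem IsTranslation.exists_lift (hφ : IsSmoothAction φ) (hfree : IsLocallyFree φ)
    (hP : IsClosedTransversal φ P p) (hc : IsTranslation φ P p c) {t s : ℝ}
    (h : p s = φ (c t) (p t)) :
    ∃ τ : ℝ → ℝ, (∀ r, p (τ r) = φ (c r) (p r)) ∧ τ t = s ∧
      ∀ d, IsTranslation φ P p d → IsTranslation φ P p fun r => d (τ r) + c r := by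
  obtain ⟨-, τ, hτ, hpτ, h0⟩ :=
    hP.exists_contDiff_lift hφ hfree hc.differentiable.continuous hc.mem h
  refine ⟨τ, hpτ, h0, fun d hd => ⟨?_, fun r => ?_⟩⟩
  · exact (hd.differentiable.comp (hτ.differentiable (by simp))).add hc.differentiable
  · rw [hφ.add_act, ← hpτ]
    exact hd.mem _

theorem IsTranslation.contDiff (hφ : IsSmoothAction φ) (hfree : IsLocallyFree φ)
    (hP : IsClosedTransversal φ P p) (hc : IsTranslation φ P p c) : ContDiff ℝ ∞ c := by
  obtain ⟨s, hs⟩ := hP.exists_eq (hc.mem 0)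
  exact (hP.exists_contDiff_lift hφ hfree hc.differentiable.continuous hc.mem hs).1

/-- If two displacements at `p t` are independent, then the displacements at another point of the
leaf differ by a dilation, which does not contract. -/
theorem TranslatesWithoutTurns.exists_dilation (hstar : TranslatesWithoutTurns φ P p)
    (hφ : IsSmoothAction φ) (hfree : IsLocallyFree φ) (hP : IsClosedTransversal φ P p)
    {a b : ℝ → Vec n} (ha : IsTranslation φ P p a) (hb : IsTranslation φ P p b) {t t' : ℝ}
    (hab : LinearIndependent ℝ ![a t, b t]) (ht : p t' ∈ leaf φ (p t)) :
    ∃ r : ℝ, 1 ≤ r ∧ ∀ d, IsTranslation φ P p d → d t' = r • d t := by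
  -- The two configurations consist of the values of all translations at `t` and at `t'`. By
  -- rigidity, points coincide in one exactly if they do in the other.
  obtain ⟨r, hr0, hr⟩ := exists_homothety (ι := {d : ℝ → Vec n // IsTranslation φ P p d})
    (x := fun d => d.1 t) (y := fun d => d.1 t')
    (fun i j => hstar.no_turn i j i.2 j.2 t t' ht)
    (fun i j => ⟨fun h => congrFun (i.2.ext hφ hfree hP j.2 h) t',
      fun h => congrFun (i.2.ext hφ hfree hP j.2 h) t⟩)
    (o := ⟨0, hP.isTranslation_zero hφ⟩) (a := ⟨a, ha⟩) (b := ⟨b, hb⟩) rfl rfl hab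
  refine ⟨r, ?_, fun d hd => hr ⟨d, hd⟩⟩
  by_contra! hr1
  obtain ⟨h, hh⟩ := ht
  -- Returns at `t'` become returns at `t` after adding `h`, which carries `p t` to `p t'`. So a
  -- factor `r < 1` gives a contraction of the returns at `t`, although `0` and `a t` are two of
  -- them.
  have hmem : ∀ x ∈ returnSet φ P p t, r • x + h ∈ returnSet φ P p t := by
    intro x hx
    obtain ⟨d, hd, rfl⟩ := hstar.exists_translation t x hx
    change φ (r • d t + h) (p t) ∈ P
    rw [hφ.add_act, ← hr ⟨d, hd⟩, show φ h (p t) = p t' from hh]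
    exact hd.mem t'
  have := subsingleton_of_contraction (hP.finite_returnSet hφ hfree t) hr0 hr1 h hmem
    (hP.zero_mem_returnSet hφ t) (ha.mem t)
  exact hab.ne_zero 0 this.symm

/-- If the displacements are nowhere collinear, then translations keep their displacement on each
leaf. -/
theorem TranslatesWithoutTurns.apply_eq_of_linearIndependent
    (hstar : TranslatesWithoutTurns φ P p) (hφ : IsSmoothAction φ) (hfree : IsLocallyFree φ) (hP : IsClosedTransversal φ P p)
    (hab : ∀ t, ∃ a b, IsTranslation φ P p a ∧ IsTranslation φ P p b ∧
      LinearIndependent ℝ ![a t, b t]) {t t' : ℝ} (ht : p t' ∈ leaf φ (p t))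
    (hd : IsTranslation φ P p d) : d t' = d t := by
  obtain ⟨a, b, ha, hb, hli⟩ := hab t
  obtain ⟨a', b', ha', hb', hli'⟩ := hab t'
  obtain ⟨r, hr, h⟩ := hstar.exists_dilation hφ hfree hP ha hb hli ht
  obtain ⟨s, hs, h'⟩ := hstar.exists_dilation hφ hfree hP ha' hb' hli' (hφ.leaf_symm ht)
  -- Going to `t'` and back gives `s * r = 1`, with both factors at least `1`.
  have h1 : (s * r - 1) • a t = 0 := by
    rw [sub_smul, one_smul, mul_smul, ← h a ha, ← h' a ha, sub_self]
  have h2 := sub_eq_zero.1 ((smul_eq_zero.1 h1).resolve_right (hli.ne_zero 0))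
  rw [h d hd, show r = 1 by nlinarith, one_smul]

end Translations

/-! ### Discrete subgroups -/

section Lattices

variable {E : Type*} [NormedAddCommGroup E]

theorem Submodule.discreteTopology_of_finite_closedBall (L : Submodule ℤ E)
    (hL : ((L : Set E) ∩ Metric.closedBall 0 1).Finite) : DiscreteTopology L := by
  have hcl : IsClosed (((L : Set E) ∩ Metric.closedBall 0 1) \ {0}) := hL.sdiff.isClosed
  obtain ⟨ε, hε, hball⟩ := Metric.isOpen_iff.1 hcl.isOpen_compl 0 (by simp)
  refine DiscreteTopology.of_forall_le_norm (r := min ε 1) (by positivity) fun x hx => ?_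
  by_contra! h
  refine hball (a := x.1) (mem_ball_zero_iff.2 (h.trans_le (min_le_left _ _))) ⟨⟨x.2, ?_⟩, ?_⟩
  · exact mem_closedBall_zero_iff.2 (h.trans_le (min_le_right _ _)).le
  · exact fun h0 => hx (Subtype.ext h0)

theorem LinearIndependent.real_of_int_of_discrete [NormedSpace ℝ E]
    [FiniteDimensional ℝ E] {ι : Type*} [Fintype ι]
    {v : ι → E} (hv : LinearIndependent ℤ v)
    (hd : DiscreteTopology (Submodule.span ℤ (Set.range v))) : LinearIndependent ℝ v := by
  rw [linearIndependent_iff_card_eq_finrank_span] at hv ⊢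
  rw [hv, Real.finrank_eq_int_finrank_of_discrete hd]

end Lattices

/-! ### Translations constant on leaves: the lattice case -/

section InvariantTranslations

variable {n : ℕ} {M : Type*} [TopologicalSpace M] [ChartedSpace (Vec (n + 1)) M]
  {φ : Vec n → M → M} {P : Set M} {p : ℝ → M}

/-- If the translations keep their displacement on each leaf, they form a group. -/
theorem TranslatesWithoutTurns.exists_submodule (hstar : TranslatesWithoutTurns φ P p)
    (hφ : IsSmoothAction φ) (hP : IsClosedTransversal φ P p)
    (hinv : ∀ d, IsTranslation φ P p d → ∀ t t', p t' ∈ leaf φ (p t) → d t' = d t) :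
    ∃ T : Submodule ℤ (ℝ → Vec n), ∀ d, d ∈ T ↔ IsTranslation φ P p d := by
  let T : AddSubgroup (ℝ → Vec n) :=
    { carrier := {d | IsTranslation φ P p d}
      zero_mem' := hP.isTranslation_zero hφ
      add_mem' := by
        intro c d hc hd
        refine ⟨hc.differentiable.add hd.differentiable, fun t => ?_⟩
        obtain ⟨s, hs⟩ := hP.exists_eq (hd.mem t)
        rw [Pi.add_apply, hφ.add_act, ← hs, ← hinv c hc t s ⟨d t, hs.symm⟩]
        exact hc.mem s
      neg_mem' := by
        intro c hc
        refine ⟨hc.differentiable.neg, fun t => ?_⟩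
        obtain ⟨s, hs⟩ := hP.exists_eq (hc.mem t)
        have h : φ (-c t) (p s) = p t := by rw [hs, hφ.neg_act]
        -- The inverse displacement at the end point `p s` extends to a translation, whose value at
        -- `t` is again `-c t` because `p t` and `p s` lie on one leaf.
        obtain ⟨e, he, hes⟩ := hstar.exists_translation s (-c t) (by rw [h]; exact hP.mem t)
        have := he.mem t
        rwa [hinv e he s t ⟨_, h⟩, hes] at this }
  exact ⟨AddSubgroup.toIntSubmodule T, fun d => Iff.rfl⟩

variable [T2Space M] [IsManifold (𝓡 (n + 1)) ∞ M]

/-- Evaluation at any parameter embeds the group of translations as a discrete subgroup of `ℝⁿ`, so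
a `ℤ`-basis is independent over `ℝ` at every parameter. In a frame extending it every translation
has constant coordinates, and the frame agrees at points of one leaf. -/
theorem TranslatesWithoutTurns.exists_isAdaptedFamily_of_invariant
    (hstar : TranslatesWithoutTurns φ P p) (hφ : IsSmoothAction φ) (hfree : IsLocallyFree φ)
    (hP : IsClosedTransversal φ P p)
    (hinv : ∀ d, IsTranslation φ P p d → ∀ t t', p t' ∈ leaf φ (p t) → d t' = d t) :
    ∃ G, IsAdaptedFamily φ P p G := by
  obtain ⟨T, hT⟩ := hstar.exists_submodule hφ hP hinv
  let ev : ℝ → T →ₗ[ℤ] Vec n := fun t => (LinearMap.proj t : (ℝ → Vec n) →ₗ[ℤ] Vec n) ∘ₗ T.subtype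
  have hev : ∀ t, Function.Injective (ev t) := fun t c d h =>
    Subtype.ext (((hT _).1 c.2).ext hφ hfree hP ((hT _).1 d.2) h)
  have hdisc : ∀ t, ∀ L ≤ LinearMap.range (ev t), DiscreteTopology L := fun t L hL => by
    refine L.discreteTopology_of_finite_closedBall
      ((hP.finite_returnSet hφ hfree t 1).subset (Set.inter_subset_inter_left _ fun x hx => ?_))
    obtain ⟨c, rfl⟩ := hL hx
    exact ((hT _).1 c.2).mem t
  have := hdisc 0 _ le_rfl
  let e := LinearEquiv.ofInjective (ev 0) (hev 0)
  have : Module.Finite ℤ T := Module.Finite.equiv e.symm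
  have : Module.Free ℤ T := Module.Free.of_equiv e.symm
  let b := Module.finBasis ℤ T
  let c : Fin (Module.finrank ℤ T) → ℝ → Vec n := fun i => (b i).1
  have hc : ∀ i, IsTranslation φ P p (c i) := fun i => (hT _).1 (b i).2
  have hcli : ∀ t, LinearIndependent ℝ fun i => c i t := fun t => by
    refine LinearIndependent.real_of_int_of_discrete
      (b.linearIndependent.map' (ev t) (LinearMap.ker_eq_bot.2 (hev t))) (hdisc t _ ?_)
    rw [Submodule.span_le]
    rintro _ ⟨i, rfl⟩
    exact ⟨b i, rfl⟩
  have hk : Module.finrank ℤ T ≤ n := by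
    simpa using (hcli 0).fintype_card_le_finrank
  obtain ⟨w, hw, hwli, hwc, hwinv⟩ :=
    exists_frame _ hk c (fun i => (hc i).contDiff hφ hfree hP) hcli
  let β : Fin n → ℝ → ℝ → ℝ := fun _ _ s => s
  have hβ : ∀ i t, Function.Bijective (β i t) := fun i t => Function.bijective_id
  refine ⟨frameMap β w, ?_, fun t => injective_frameMap (fun i => (hβ i t).1) (hwli t),
    fun t => surjective_frameMap (fun i => (hβ i t).2) (hwli t),
    fun t k => injective_fderiv_frameMap (fun i => ⟨1, one_ne_zero, hasDerivAt_id _⟩) (hwli t),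
    fun t => by simp [frameMap, β], ?_, ?_⟩
  · exact contDiff_frameMap (fun i => contDiff_fst) hw
  · intro t t' γ h k
    have h1 : ∀ i, w i t' = w i t :=
      hwinv _ _ fun i => hinv _ (hc i) _ _ ⟨_, h⟩
    simp only [frameMap, β, h1, PiLp.add_apply, add_smul, Finset.sum_add_distrib]
    abel
  · intro t γ h s
    obtain ⟨d, hd, hdt⟩ := hstar.exists_translation t _ h
    have hsum : ∃ m : Fin n → ℝ, ∀ r, d r = ∑ i, m i • w i r := by
      let N := b.repr ⟨d, (hT d).2 hd⟩
      -- The integer coordinates in the basis are filled up by `0` on the added frame vectors.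
      refine ⟨Function.extend (Fin.castLE hk) (fun i => (N i : ℝ)) 0, fun r => ?_⟩
      have h1 : d r = ∑ i, (N i : ℝ) • c i r := by
        have := congrArg (ev r) (b.sum_repr ⟨d, (hT d).2 hd⟩)
        rw [map_sum] at this
        refine this.symm.trans (Finset.sum_congr rfl fun i _ => ?_)
        rw [map_zsmul, Int.cast_smul_eq_zsmul]
        rfl
      have hinj : Function.Injective (Fin.castLE hk) := Fin.castLE_injective hk
      rw [h1]
      refine Finset.sum_of_injOn (Fin.castLE hk) hinj.injOn (fun _ _ => Finset.mem_coe.2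
        (Finset.mem_univ _)) (fun i _ hi => ?_) fun i _ => ?_
      · rw [Function.extend_apply', Pi.zero_apply, zero_smul]
        rintro ⟨j, rfl⟩
        exact hi ⟨j, by simp, rfl⟩
      · rw [hinj.extend_apply, hwc]
    obtain ⟨m, hm⟩ := hsum
    have h2 : ∀ i, γ i = m i := (frameMap_eq_iff (hwli t)).1 (hdt.symm.trans (hm t))
    have h3 : frameMap β w s γ = d s := by
      rw [hm]
      exact (frameMap_eq_iff (hwli s)).2 h2
    rw [h3]
    exact hd.mem s

end InvariantTranslations

/-! ### Collinear displacements: translations indexed by `ℤ` -/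

section CollinearTranslations

variable {n : ℕ} {M : Type*} [TopologicalSpace M] [ChartedSpace (Vec (n + 1)) M]
  {φ : Vec n → M → M} {P : Set M} {p : ℝ → M}

/-- An enumeration by `ℤ` of all translations along a transversal, compatible with composition. -/
structure IsTranslationSequence (φ : Vec n → M → M) (P : Set M) (p : ℝ → M)
    (c : ℤ → ℝ → Vec n) : Prop where
  isTranslation : ∀ m, IsTranslation φ P p (c m)
  zero : c 0 = 0
  one_ne_zero : ∀ t, c 1 t ≠ 0
  exists_eq : ∀ d, IsTranslation φ P p d → ∃ m, d = c m
  add : ∀ m j t t', p t' = φ (c j t) (p t) → c (m + j) t = c m t' + c j t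

variable [T2Space M] [IsManifold (𝓡 (n + 1)) ∞ M]

/-- If the returns to one point of `P` are collinear, then the translations along `P` form a
sequence. -/
theorem TranslatesWithoutTurns.exists_isTranslationSequence
    (hstar : TranslatesWithoutTurns φ P p) (hφ : IsSmoothAction φ) (hfree : IsLocallyFree φ)
    (hP : IsClosedTransversal φ P p) {t₀ : ℝ} {d₀ : ℝ → Vec n} (hd₀ : IsTranslation φ P p d₀)
    (hne : d₀ t₀ ≠ 0) (hcol : ∀ d, IsTranslation φ P p d → ∃ x : ℝ, d t₀ = x • d₀ t₀) :
    ∃ c, IsTranslationSequence φ P p c := by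
  obtain ⟨u, hu⟩ : ∃ u, u = d₀ t₀ := ⟨_, rfl⟩
  rw [← hu] at hne
  simp only [← hu] at hcol
  have hinj : Function.Injective fun x : ℝ => x • u := smul_left_injective ℝ hne
  have h0 := hP.isTranslation_zero hφ
  -- No turning in coordinates: if one translation is ahead of another in the direction `u` at `t`,
  -- it is ahead at every other point of the leaf.
  have hray : ∀ c₁ c₂, IsTranslation φ P p c₁ → IsTranslation φ P p c₂ → ∀ t t',
      p t' ∈ leaf φ (p t) → ∀ r : ℝ, 0 < r → c₁ t - c₂ t = r • u →
        ∃ r' : ℝ, 0 < r' ∧ c₁ t' - c₂ t' = r' • u := by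
    intro c₁ c₂ h₁ h₂ t t' ht r hr h
    have hs := hstar.no_turn c₁ c₂ h₁ h₂ t t' ht
    have hn : c₁ t' - c₂ t' ≠ 0 := fun hz => by
      rw [h₁.ext hφ hfree hP h₂ (sub_eq_zero.1 hz), sub_self] at h
      exact smul_ne_zero hr.ne' hne h.symm
    rw [h] at hs
    obtain ⟨q, hq, hq'⟩ := hs.exists_pos_left (smul_ne_zero hr.ne' hne) hn
    exact ⟨q * r, mul_pos hq hr, by rw [mul_smul, hq']⟩
  have hmul : ∀ h ∈ returnSet φ P p t₀, ∃ x : ℝ, h = x • u := by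
    intro h hh
    obtain ⟨d, hd, rfl⟩ := hstar.exists_translation t₀ h hh
    exact hcol d hd
  have hadd : ∀ {h : Vec n} {t}, p t = φ h (p t₀) → ∀ k,
      k + h ∈ returnSet φ P p t₀ ↔ k ∈ returnSet φ P p t := by
    intro h t ht k
    change φ (k + h) (p t₀) ∈ P ↔ φ k (p t) ∈ P
    rw [hφ.add_act, ht]
  let S : Set ℝ := {x | x • u ∈ returnSet φ P p t₀}
  have hS0 : (0 : ℝ) ∈ S := by
    change (0 : ℝ) • u ∈ returnSet φ P p t₀
    rw [zero_smul]
    exact hP.zero_mem_returnSet hφ t₀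
  have hfin : ∀ a b, (S ∩ Set.Icc a b).Finite := by
    intro a b
    refine ((hP.finite_returnSet hφ hfree t₀ (max |a| |b| * ‖u‖)).preimage hinj.injOn).subset ?_
    rintro x ⟨hx, hx'⟩
    refine ⟨hx, mem_closedBall_zero_iff.2 ?_⟩
    simp only [norm_smul, Real.norm_eq_abs]
    exact mul_le_mul_of_nonneg_right (abs_le_max_abs_abs hx'.1 hx'.2) (norm_nonneg _)
  have hstep : ∀ e, IsTranslation φ P p e → ∀ x ∈ S, ∃ t y, p t = φ (x • u) (p t₀) ∧
      e t = y • u ∧ y + x ∈ S := by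
    intro e he x hx
    obtain ⟨t, ht⟩ := hP.exists_eq hx
    have h1 := (hadd ht (e t)).2 (he.mem t)
    obtain ⟨z, hz⟩ := hmul _ h1
    refine ⟨t, z - x, ht, by rw [sub_smul, ← hz, add_sub_cancel_right], ?_⟩
    change (z - x + x) • u ∈ returnSet φ P p t₀
    rwa [sub_add_cancel, ← hz]
  -- Applying `d₀` at the return point `x • u` moves further in the positive direction.
  have htop : ∀ x ∈ S, ∃ y ∈ S, x < y := by
    intro x hx
    obtain ⟨t, y, ht, hy, hyS⟩ := hstep d₀ hd₀ x hx
    obtain ⟨r, hr, h⟩ := hray d₀ 0 hd₀ h0 t₀ t ⟨_, ht.symm⟩ 1 one_pos (by simp [hu])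
    have : y = r := hinj (by simpa [hy] using h)
    exact ⟨_, hyS, by linarith⟩
  have hbot : ∀ x ∈ S, ∃ y ∈ S, y < x := by
    obtain ⟨s, hs⟩ := hP.exists_eq (hd₀.mem t₀)
    -- This translation undoes `d₀` at its end point. It moves backwards there, hence at `t₀` and at
    -- every other return point.
    obtain ⟨e, he, hes⟩ := hstar.exists_translation s (-u)
      ((hadd hs (-u)).1 (by rw [hu, neg_add_cancel]; exact hP.zero_mem_returnSet hφ t₀))
    intro x hx
    obtain ⟨t, y, ht, hy, hyS⟩ := hstep e he x hx
    obtain ⟨q, hq, hq'⟩ := hray 0 e h0 he s t₀ (hφ.leaf_symm ⟨_, hs.symm⟩) 1 one_pos (by simp [hes])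
    obtain ⟨r, hr, h⟩ := hray 0 e h0 he t₀ t ⟨_, ht.symm⟩ q hq hq'
    have : -y = r := hinj (by simpa [hy] using h)
    exact ⟨_, hyS, by linarith⟩
  obtain ⟨e₁⟩ := exists_orderIso_int hfin ⟨0, hS0⟩ htop hbot
  obtain ⟨e, he0⟩ : ∃ e : ℤ ≃o S, e 0 = ⟨0, hS0⟩ :=
    ⟨(OrderIso.addRight (e₁.symm ⟨0, hS0⟩)).trans e₁, by simp⟩
  choose c hc hct using fun m => hstar.exists_translation t₀ _ (e m).2
  have hc0 : c 0 = 0 := (hc 0).ext hφ hfree hP h0 (t := t₀) (by simp [hct, he0])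
  have hex : ∀ d, IsTranslation φ P p d → ∃ m, d = c m := by
    intro d hd
    obtain ⟨x, hx⟩ := hcol d hd
    have hxS : x ∈ S := by
      change x • u ∈ returnSet φ P p t₀
      exact hx ▸ hd.mem t₀
    refine ⟨e.symm ⟨x, hxS⟩, hd.ext hφ hfree hP (hc _) (t := t₀) ?_⟩
    rw [hct, hx, OrderIso.apply_symm_apply]
  have hbase : ∀ m j t, p t = φ (c j t₀) (p t₀) → c (m + j) t₀ = c m t + c j t₀ := by
    intro m j t ht
    have hg : ∀ m, ∃ s : S, s.1 • u = c m t + c j t₀ := by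
      intro m
      have h1 := (hadd ht (c m t)).2 ((hc m).mem t)
      obtain ⟨z, hz⟩ := hmul _ h1
      exact ⟨⟨z, by rw [hz] at h1; exact h1⟩, hz.symm⟩
    choose g hg using hg
    -- The map `g` records where `c m` leads after `c j`. It is increasing and onto `S`, so in the
    -- enumeration it is an order automorphism of `ℤ`, hence a shift, and `g 0 = e j` makes it the
    -- shift by `j`.
    have hmono : StrictMono g := by
      intro a b hab
      have h1 : (e a).1 < (e b).1 := e.strictMono hab
      obtain ⟨r, hr, h⟩ := hray (c b) (c a) (hc b) (hc a) t₀ t ⟨_, ht.symm⟩ _ (sub_pos.2 h1)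
        (by rw [hct, hct, sub_smul])
      have h2 : (g b).1 - (g a).1 = r := hinj (by
        change ((g b).1 - (g a).1) • u = r • u
        rw [← h, sub_smul, hg, hg, add_sub_add_right_eq_sub])
      exact Subtype.coe_lt_coe.1 (by linarith)
    have hsurj : Function.Surjective g := by
      intro s
      have h1 : s.1 • u - c j t₀ ∈ returnSet φ P p t :=
        (hadd ht _).1 (by rw [sub_add_cancel]; exact s.2)
      obtain ⟨d, hd, hdt⟩ := hstar.exists_translation t _ h1
      obtain ⟨m, rfl⟩ := hex d hd
      exact ⟨m, Subtype.ext (hinj (by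
        change (g m).1 • u = s.1 • u
        rw [hg, hdt, sub_add_cancel]))⟩
    let f : ℤ ≃o ℤ := (hmono.orderIsoOfSurjective g hsurj).trans e.symm
    have hf : ∀ m, e (f m) = g m := fun m => e.apply_symm_apply _
    have hf0 : f 0 = j := by
      have h1 : g 0 = e j := Subtype.ext (hinj (by
        change (g 0).1 • u = (e j).1 • u
        rw [hg, hc0, Pi.zero_apply, zero_add, hct]))
      exact e.injective ((hf 0).trans h1)
    rw [← hg, ← hf, f.int_apply_eq, hf0, hct]
  refine ⟨c, hc, hc0, fun t h => ?_, hex, fun m j t t' ht => ?_⟩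
  · have h1 : c 1 t₀ = 0 := congrFun ((hc 1).ext hφ hfree hP h0 (t := t) h) t₀
    rw [hct] at h1
    have h2 : e 1 = e 0 := by
      rw [he0]
      exact Subtype.ext ((smul_eq_zero.1 h1).resolve_right hne)
    exact one_ne_zero (e.injective h2)
  -- The composition law holds at `t₀`; both sides are translations, so by rigidity it holds at
  -- every parameter.
  · obtain ⟨τ, hτ, rfl, htr⟩ := (hc j).exists_lift hφ hfree hP ht
    exact congrFun ((hc (m + j)).ext hφ hfree hP (htr _ (hc m)) (t := t₀)
      (hbase m j _ (hτ t₀))) t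

end CollinearTranslations

/-! ### The adapted family in the collinear case, and the case distinction -/

section CollinearCase

/-- A strictly increasing sequence of real numbers, indexed by `ℤ` and locally finite, is
unbounded in both directions. -/
theorem StrictMono.exists_le_and_exists_ge {x : ℤ → ℝ} (hx : StrictMono x)
    (hfin : ∀ r, {m | |x m| ≤ r}.Finite) (r : ℝ) : (∃ m, r ≤ x m) ∧ ∃ m, x m ≤ r := by
  constructor <;> by_contra! h
  · refine Set.Ici_infinite (0 : ℤ) ((hfin (max |x 0| |r|)).subset fun m hm => ?_)
    exact abs_le_max_abs_abs (hx.monotone hm) (h m).le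
  · refine Set.Iic_infinite (0 : ℤ) ((hfin (max |r| |x 0|)).subset fun m hm => ?_)
    exact abs_le_max_abs_abs (h m).le (hx.monotone hm)

variable {n : ℕ} {M : Type*} [TopologicalSpace M] [ChartedSpace (Vec (n + 1)) M]
  {φ : Vec n → M → M} {P : Set M} {p : ℝ → M} [T2Space M] [IsManifold (𝓡 (n + 1)) ∞ M]

/-- Each increment of the sequence is the first displacement at another point of the leaf, so all
have the direction `u t`, constant on leaves. Interpolating the partial sums of their lengths puts
the returns at the integer points of one coordinate axis; moving to another return point shifts the
increments. -/
theorem IsTranslationSequence.exists_isAdaptedFamily {c : ℤ → ℝ → Vec n}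
    (hc : IsTranslationSequence φ P p c) (hstar : TranslatesWithoutTurns φ P p)
    (hφ : IsSmoothAction φ) (hfree : IsLocallyFree φ) (hP : IsClosedTransversal φ P p) :
    ∃ G, IsAdaptedFamily φ P p G := by
  have hcs : ∀ m, ContDiff ℝ ∞ (c m) := fun m => (hc.isTranslation m).contDiff hφ hfree hP
  have hstep : ∀ m t, ∃ t', p t' ∈ leaf φ (p t) ∧ c (m + 1) t - c m t = c 1 t' := by
    intro m t
    obtain ⟨t', ht'⟩ := hP.exists_eq ((hc.isTranslation m).mem t)
    refine ⟨t', ⟨_, ht'.symm⟩, ?_⟩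
    rw [add_comm m 1, hc.add 1 m t t' ht', add_sub_cancel_right]
  have hdne : ∀ m t, c (m + 1) t - c m t ≠ 0 := fun m t => by
    obtain ⟨t', -, h⟩ := hstep m t
    rw [h]
    exact hc.one_ne_zero t'
  obtain ⟨u, hu⟩ : ∃ u : ℝ → Vec n, ∀ t, u t = ‖c 1 t‖⁻¹ • c 1 t := ⟨_, fun _ => rfl⟩
  have hus : ContDiff ℝ ∞ u := by
    rw [funext hu]
    exact ((hcs 1).norm ℝ hc.one_ne_zero).inv (fun t => norm_ne_zero_iff.2 (hc.one_ne_zero t))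
      |>.smul (hcs 1)
  have hu0 : ∀ t, u t ≠ 0 := fun t => by
    rw [hu]
    exact smul_ne_zero (inv_ne_zero (norm_ne_zero_iff.2 (hc.one_ne_zero t))) (hc.one_ne_zero t)
  have huleaf : ∀ t t', p t' ∈ leaf φ (p t) → u t = u t' := fun t t' h => by
    have h1 := hstar.no_turn _ _ (hc.isTranslation 1) (hc.isTranslation 0) t t' h
    rw [hc.zero, Pi.zero_apply, Pi.zero_apply, sub_zero, sub_zero] at h1
    rw [hu, hu, h1.inv_norm_smul_eq (hc.one_ne_zero t) (hc.one_ne_zero t')]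
  obtain ⟨ℓ, hℓ⟩ : ∃ ℓ : ℤ → ℝ → ℝ, ∀ m t, ℓ m t = ‖c (m + 1) t - c m t‖ := ⟨_, fun _ _ => rfl⟩
  have hℓpos : ∀ m t, 0 < ℓ m t := fun m t => by
    rw [hℓ]
    exact norm_pos_iff.2 (hdne m t)
  have hℓs : ∀ m, ContDiff ℝ ∞ (ℓ m) := fun m => by
    rw [funext (hℓ m)]
    exact ((hcs (m + 1)).sub (hcs m)).norm ℝ (hdne m)
  have hℓshift : ∀ j t t', p t' = φ (c j t) (p t) → ∀ m, ℓ m t' = ℓ (m + j) t := by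
    intro j t t' h m
    rw [hℓ, hℓ, add_right_comm, hc.add _ j t t' h, hc.add _ j t t' h, add_sub_add_right_eq_sub]
  have hdiff : ∀ m t, c (m + 1) t = c m t + ℓ m t • u t := by
    intro m t
    obtain ⟨t', ht', h⟩ := hstep m t
    rw [hℓ, ← sub_eq_iff_eq_add', h, huleaf t t' ht', hu,
      smul_inv_smul₀ (norm_ne_zero_iff.2 (hc.one_ne_zero t'))]
  obtain ⟨x, hx⟩ : ∃ x : ℝ → ℤ → ℝ, ∀ t m, x t m = interp (fun m => ℓ m t) m :=
    ⟨_, fun _ _ => rfl⟩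
  have hx0 : ∀ t, x t 0 = 0 := fun t => by rw [hx, Int.cast_zero, interp_zero]
  have hxstep : ∀ t m, x t (m + 1) = x t m + ℓ m t := fun t m => by
    have h1 := interp_add_intCast (fun m => ℓ m t) 1 m
    rw [interp_one, zero_add] at h1
    rw [hx, hx, Int.cast_add, Int.cast_one, add_comm (m : ℝ), h1]
  have hcx : ∀ t m, c m t = x t m • u t := by
    intro t m
    induction m with
    | zero => rw [hc.zero, hx0, zero_smul, Pi.zero_apply]
    | succ m ih => rw [hdiff, ih, hxstep, add_smul]
    | pred m ih =>
      have h1 := hdiff (-(m : ℤ) - 1) t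
      have h2 := hxstep t (-(m : ℤ) - 1)
      rw [sub_add_cancel] at h1 h2
      rw [ih, h2, add_smul] at h1
      exact (add_right_cancel h1).symm
  have hxmono : ∀ t, StrictMono (x t) := fun t =>
    strictMono_int_of_lt_succ fun m => by rw [hxstep]; linarith [hℓpos m t]
  have hxfin : ∀ t r, {m | |x t m| ≤ r}.Finite := by
    intro t r
    refine ((hP.finite_returnSet hφ hfree t (r * ‖u t‖)).preimage (f := fun m => c m t)
      (Function.Injective.injOn ?_)).subset fun m hm => ⟨(hc.isTranslation m).mem t, ?_⟩
    · intro a b hab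
      simp only [hcx] at hab
      exact (hxmono t).injective (smul_left_injective ℝ (hu0 t) hab)
    · simp only [mem_closedBall_zero_iff, hcx, norm_smul, Real.norm_eq_abs]
      exact mul_le_mul_of_nonneg_right hm (norm_nonneg _)
  have hbij : ∀ t, Function.Bijective (interp fun m => ℓ m t) := fun t => by
    have h := bijective_interp (fun m => hxmono t (lt_add_one m)) (hx0 t)
      (fun r => ((hxmono t).exists_le_and_exists_ge (hxfin t) r).1)
      (fun r => ((hxmono t).exists_le_and_exists_ge (hxfin t) r).2)
    simpa only [hxstep, add_sub_cancel_left] using h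
  have hn : 1 ≤ n := by
    rw [Nat.one_le_iff_ne_zero]
    rintro rfl
    exact hu0 0 (Subsingleton.elim _ _)
  obtain ⟨w, hw, hwli, hwu, hwinv⟩ := exists_frame 1 hn (fun _ => u) (fun _ => hus)
    (fun t => LinearIndependent.of_subsingleton 0 (hu0 t))
  obtain ⟨o, ho⟩ : ∃ o, o = Fin.castLE hn 0 := ⟨_, rfl⟩
  have hwo : w o = u := ho ▸ hwu 0
  let β : Fin n → ℝ → ℝ → ℝ := fun i t s => if i = o then interp (fun m => ℓ m t) s else s
  have hβo : ∀ t s, β o t s = interp (fun m => ℓ m t) s := fun t s => if_pos rfl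
  have hβi : ∀ i ≠ o, ∀ t s, β i t s = s := fun i hi t s => if_neg hi
  have hβ : ∀ i t, Function.Bijective (β i t) := by
    intro i t
    by_cases hi : i = o
    · subst hi
      rw [funext (hβo t)]
      exact hbij t
    · rw [funext (hβi i hi t)]
      exact Function.bijective_id
  -- The label of the return `c j t` is `j` times the basis vector `o`, whatever `t` is.
  have hGc : ∀ j t γ, frameMap β w t γ = c j t ↔ ∀ i, γ i = if i = o then (j : ℝ) else 0 := by
    intro j t γ
    have h1 : c j t = ∑ i, (if i = o then x t j else 0) • w i t := by
      simp [hwo, hcx]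
    rw [h1, frameMap_eq_iff (hwli t)]
    refine forall_congr' fun i => ?_
    by_cases hi : i = o
    · subst hi
      rw [if_pos rfl, if_pos rfl, hβo, hx, (hbij t).1.eq_iff]
    · rw [if_neg hi, if_neg hi, hβi i hi]
  refine ⟨frameMap β w, ?_, fun t => injective_frameMap (fun i => (hβ i t).1) (hwli t),
    fun t => surjective_frameMap (fun i => (hβ i t).2) (hwli t), fun t k =>
    injective_fderiv_frameMap (fun i => ?_) (hwli t), fun t => ?_, ?_, ?_⟩
  · refine contDiff_frameMap (fun i => ?_) hw
    by_cases hi : i = o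
    · subst hi
      simp only [hβo]
      exact contDiff_interp hℓs hℓpos
    · simp only [hβi i hi]
      exact contDiff_fst
  · by_cases hi : i = o
    · subst hi
      obtain ⟨d, hd, h⟩ := exists_hasDerivAt_interp (fun m => hℓpos m t) (k i)
      exact ⟨d, hd.ne', by rwa [funext (hβo t)]⟩
    · exact ⟨1, _root_.one_ne_zero, by rw [funext (hβi i hi t)]; exact hasDerivAt_id _⟩
  · have h := (hGc 0 t 0).2 (by simp)
    rwa [hc.zero] at h
  · intro t t' γ h k
    obtain ⟨d, hd, hdt⟩ := hstar.exists_translation t (frameMap β w t γ) (h ▸ hP.mem t')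
    obtain ⟨j, rfl⟩ := hc.exists_eq d hd
    have hγ := (hGc j t γ).1 hdt.symm
    have hwt : ∀ i, w i t' = w i t :=
      hwinv _ _ fun _ => (huleaf t t' ⟨_, h⟩).symm
    rw [← hdt] at h
    simp only [frameMap, hwt, ← Finset.sum_sub_distrib, ← sub_smul]
    refine Finset.sum_congr rfl fun i _ => ?_
    congr 1
    by_cases hi : i = o
    · subst hi
      rw [PiLp.add_apply, hγ, if_pos rfl, hβo, hβo, hβo, interp_add_intCast, add_sub_cancel_left,
        funext fun m => hℓshift j t t' h.symm m]
    · rw [PiLp.add_apply, hβi i hi, hβi i hi, hβi i hi, add_sub_cancel_right]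
  · intro t γ h s
    obtain ⟨d, hd, hdt⟩ := hstar.exists_translation t _ h
    obtain ⟨j, rfl⟩ := hc.exists_eq d hd
    rw [(hGc j s γ).2 ((hGc j t γ).1 hdt.symm)]
    exact (hc.isTranslation j).mem s

/-- Condition `(*)` provides an adapted family. -/
theorem TranslatesWithoutTurns.exists_isAdaptedFamily (hstar : TranslatesWithoutTurns φ P p)
    (hφ : IsSmoothAction φ) (hfree : IsLocallyFree φ) (hP : IsClosedTransversal φ P p) :
    ∃ G, IsAdaptedFamily φ P p G := by
  -- The alternative is one parameter `t₀` at which all displacements are collinear; if all vanish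
  -- there, the zero translation is the only one and the lattice case applies.
  by_cases hab : ∀ t, ∃ a b, IsTranslation φ P p a ∧ IsTranslation φ P p b ∧
      LinearIndependent ℝ ![a t, b t]
  · exact hstar.exists_isAdaptedFamily_of_invariant hφ hfree hP fun d hd t t' ht =>
      hstar.apply_eq_of_linearIndependent hφ hfree hP hab ht hd
  push Not at hab
  obtain ⟨t₀, hab⟩ := hab
  by_cases h0 : ∃ d, IsTranslation φ P p d ∧ d t₀ ≠ 0
  · obtain ⟨d₀, hd₀, hne⟩ := h0
    have hcol : ∀ d, IsTranslation φ P p d → ∃ x : ℝ, d t₀ = x • d₀ t₀ := by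
      intro d hd
      have h1 := hab d₀ d hd₀ hd
      rw [LinearIndependent.pair_iff' hne] at h1
      push Not at h1
      obtain ⟨x, hx⟩ := h1
      exact ⟨x, hx.symm⟩
    obtain ⟨c, hc⟩ := hstar.exists_isTranslationSequence hφ hfree hP hd₀ hne hcol
    exact hc.exists_isAdaptedFamily hstar hφ hfree hP
  · push Not at h0
    refine hstar.exists_isAdaptedFamily_of_invariant hφ hfree hP fun d hd t t' _ => ?_
    rw [hd.ext hφ hfree hP (hP.isTranslation_zero hφ) (h0 d hd)]
    rfl

end CollinearCase

theorem mainTheorem1 (n : ℕ) {M : Type*} [TopologicalSpace M] [T2Space M]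
    [SecondCountableTopology M] [ChartedSpace (Vec (n + 1)) M] [IsManifold (𝓡 (n + 1)) ∞ M]
    (φ : Vec n → M → M) (hφ : IsSmoothAction φ) (hfree : IsLocallyFree φ)
    (P : Set M) (p : ℝ → M) (hP : IsClosedTransversal φ P p)
    (hstar : TranslatesWithoutTurns φ P p) :
    ∃ ψ : Vec n → M → M, IsSmoothAction ψ ∧ IsLocallyFree ψ ∧ (∀ x, leaf ψ x = leaf φ x) ∧
      IsInvariantTransversal ψ P ∧
      ∃ D : ∀ x : M, Submodule ℝ (TangentSpace (𝓡 (n + 1)) x),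
        IsEhresmannConnection φ D ∧ IsInvariantField ψ D ∧
        ∀ t, D (p t) = Submodule.span ℝ {velocity p t} := by
  obtain ⟨G, hG⟩ := hstar.exists_isAdaptedFamily hφ hfree hP
  exact hG.exists_action hφ hfree hP
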